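/- **Setting.** Let $d\ge 2$, let $\Omega\subset\mathbb R^d$ be a bounded polyhedral Lipschitz domain with $\partial\Omega=\overline{\Gamma}_D\cup\overline{\Gamma}_N$, where $\Gamma_D,\Gamma_N$ are disjoint and relatively open in $\partial\Omega$ and $\Gamma_D\neq\emptyset$, and let $\mathcal T_h$ be a conforming triangulation of $\Omega$ into closed simplices such that the relative interior of every boundary side lies either in $\Gamma_D$ (Dirichlet side) or in $\Gamma_N$ (Neumann side). Let $\mathbb P^k(\mathcal T_h)$ be the element-wise polynomials of degree at most $k$, $\Pi_h$ the $L^2$-projection onto element-wise constants, $\nabla_h,\operatorname{div}_h$ the element-wise gradient and divergence, $(\cdot,\cdot)_\Omega$ the $L^2$ inner product, $I$ the identity matrix, and $\operatorname{dev}A=A-\tfrac1d\operatorname{tr}(A)I$. Let * $V^h$ be the Crouzeix–Raviart space of all $v_h\in\mathbb P^1(\mathcal T_h)^d$ whose jumps across interior sides have mean value zero, and $V_D^h$ the subspace of those whose mean value vanishes on every Dirichlet side; * $\Sigma_N^h$ be the Raviart–Thomas space of all $\tau_h\in\mathbb P^1(\mathcal T_h)^{d\times d}$ whose normal components $\tau_h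 n$ are constant on each side of each simplex, continuous across interior sides, and zero on the Neumann sides; its divergence is taken row-wise. Let $\nu>0$, $f_h\in\mathbb P^0(\mathcal T_h)^d$, $F_h\in\mathbb P^0(\mathcal T_h)^{d\times d}$ and $\hat u_D^h\in V^h$ with $\operatorname{div}_h\hat u_D^h=0$. A *discrete primal solution* is an element of $K_u^h=\{v_h\in V_D^h:\operatorname{div}_hv_h=0\}$ that minimises, over $V_D^h$, $$I_h(v_h)=\tfrac\nu2\|\nabla_h(v_h+\hat u_D^h)\|_\Omega^2-(f_h,\Pi_hv_h)_\Omega-(F_h,\nabla_hv_h)_\Omega\ \text{ if }\operatorname{div}_hv_h=0,\qquad I_h(v_h)=+\infty\ \text{ otherwise}.$$ A *discrete dual solution* is an element of $K_T^h=\{\tau_h\in F_h+\Sigma_N^h:\operatorname{div}(\tau_h-F_h)=-f_h\}$ that maximises, over $F_h+\Sigma_N^h$, $$D_h(\tau_h)=-\tfrac1{2\nu}\|\operatorname{dev}\Pi_h\tau_h\|_\Omega^2+(\operatorname{dev}\Pi_h\tau_h,\nabla_h\hat u_D^h)_\Omega\ \text{ if }\operatorname{div}(\tau_h-F_h)=-f_h,\qquad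 D_h(\tau_h)=-\infty\ \text{ otherwise}.$$ **Proposition 3.1.** (i) Let $u_h\in K_u^h$ be a discrete primal solution (the discrete velocity) and let $p_h\in\mathbb P^0(\mathcal T_h)$ (a discrete pressure) satisfy, for all $v_h\in V_D^h$, $$(\nu\nabla_h(u_h+\hat u_D^h)-p_hI,\nabla_hv_h)_\Omega=(f_h,v_h)_\Omega+(F_h,\nabla_hv_h)_\Omega .$$ Then $$T_h=\nu\nabla_h(u_h+\hat u_D^h)-p_hI-\tfrac1d f_h\otimes(\mathrm{id}-\Pi_h\mathrm{id})$$ is a discrete dual solution (the discrete stress); in particular $T_h-F_h\in\Sigma_N^h$ and $\operatorname{div}(T_h-F_h)=-f_h$. Every discrete dual solution equals $T_h+cI$ for some constant $c\in\mathbb R$, and $c=0$ if $\Gamma_N\neq\emptyset$. (ii) Let $T_h\in K_T^h$ be a discrete dual solution and let $\bar u_h\in\mathbb P^0(\mathcal T_h)^d$ satisfy, for all $\tau_h\in\Sigma_N^h$, $$-\tfrac1\nu(\operatorname{dev}\Pi_hT_h,\operatorname{dev}\Pi_h\tau_h)_\Omega-(\bar u_h,\operatorname{div}\tau_h)_\Omega=-(\nabla_h\hat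 u_D^h,\operatorname{dev}\Pi_h\tau_h)_\Omega .$$ Then $$u_h=\bar u_h+\bigl(\tfrac1\nu\operatorname{dev}\Pi_hT_h-\nabla_h\hat u_D^h\bigr)(\mathrm{id}-\Pi_h\mathrm{id})$$ is the unique discrete primal solution. -/

import Mathlib

open MeasureTheory Topology
open scoped NNReal Matrix

noncomputable section

namespace StokesCR

/-- The Euclidean space `ℝ^d`. -/
abbrev Space (d : ℕ) := EuclideanSpace ℝ (Fin d)

/-- Real `d × d` tensors. -/
abbrev Tensor (d : ℕ) := Matrix (Fin d) (Fin d) ℝ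

/-! ### Tensor algebra -/

/-- The Frobenius product `A : B`. -/
def frob {d : ℕ} (A B : Tensor d) : ℝ := ∑ i, ∑ j, A i j * B i j

/-- The deviatoric part `A - (1/d) tr(A) I`. -/
def dev {d : ℕ} (A : Tensor d) : Tensor d := A - (A.trace / (d : ℝ)) • (1 : Tensor d)

/-- The dyadic product `(a ⊗ b)_{ij} = a_i b_j`. -/
def dyad {d : ℕ} (a b : Space d) : Tensor d := Matrix.of fun i j => a i * b j

/-- The matrix-vector product `A x`. -/
def act {d : ℕ} (A : Tensor d) (x : Space d) : Space d := WithLp.toLp 2 (A *ᵥ x.ofLp)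

/-- The gradient (Jacobian) of an affine vector field, `(∇v)_{ij} = ∂_j v_i`. -/
def grad {d : ℕ} (v : Space d →ᵃ[ℝ] Space d) : Tensor d :=
  Matrix.of fun i j => v.linear (EuclideanSpace.single j 1) i

/-- The divergence of an affine vector field, `div v = ∑_i ∂_i v_i`. -/
def vdiv {d : ℕ} (v : Space d →ᵃ[ℝ] Space d) : ℝ :=
  ∑ i, v.linear (EuclideanSpace.single i 1) i

/-- The row-wise divergence of an affine tensor field, `(div τ)_i = ∑_j ∂_j τ_{ij}`. -/
def tdiv {d : ℕ} (τ : Space d →ᵃ[ℝ] Tensor d) : Space d :=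
  WithLp.toLp 2 fun i => ∑ j, τ.linear (EuclideanSpace.single j 1) i j

/-! ### Domain and boundary parts -/

/-- A bounded Lipschitz domain: a bounded, connected open set that, near each boundary point and in
suitable orthonormal coordinates, is the set of points on one side of a Lipschitz graph
(`y - ⟪n, y⟫ n` are the coordinates of `y` orthogonal to `n`). -/
structure IsLipschitzDomain {d : ℕ} (Ω : Set (Space d)) : Prop where
  isOpen : IsOpen Ω
  isConnected : IsConnected Ω
  isBounded : Bornology.IsBounded Ω
  graph : ∀ x ∈ frontier Ω, ∃ (n : Space d) (φ : Space d → ℝ) (L : ℝ≥0), ∃ U ∈ 𝓝 x,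
    ‖n‖ = 1 ∧ LipschitzWith L φ ∧ ∀ y ∈ U, (y ∈ Ω ↔ φ (y - inner ℝ n y • n) < inner ℝ n y)

/-- The boundary of `Ω` is divided into a nonempty relatively open Dirichlet part and a (possibly
empty) relatively open Neumann part. -/
structure IsBoundaryPartition {d : ℕ} (Ω ΓD ΓN : Set (Space d)) : Prop where
  relOpen_D : ∃ U, IsOpen U ∧ ΓD = U ∩ frontier Ω
  relOpen_N : ∃ U, IsOpen U ∧ ΓN = U ∩ frontier Ω
  closure_union : closure ΓD ∪ closure ΓN = frontier Ω
  disjoint : Disjoint ΓD ΓN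
  nonempty_D : ΓD.Nonempty

/-! ### Triangulations -/

/-- The closed simplex spanned by a finite set of vertices. -/
abbrev hull {d : ℕ} (T : Finset (Space d)) : Set (Space d) := convexHull ℝ (T : Set (Space d))

/-- A conforming triangulation of (the closure of) `Ω` into finitely many nondegenerate closed
simplices. Simplices are given by their vertices; two of them meet at most in a common face. Its
existence makes `Ω` polyhedral. -/
structure Triangulation (d : ℕ) (Ω : Set (Space d)) where
  cells : Finset (Finset (Space d))
  card_eq : ∀ T ∈ cells, T.card = d + 1
  indep : ∀ T ∈ cells, AffineIndependent ℝ ((↑) : T → Space d)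
  inter_subset : ∀ T ∈ cells, ∀ T' ∈ cells,
    hull T ∩ hull T' ⊆ convexHull ℝ ((T : Set (Space d)) ∩ (T' : Set (Space d)))
  cover : ⋃ T ∈ cells, hull T = closure Ω

/-- `n` is the outer unit normal of the simplex `T` on its side `S`. -/
def IsOuterNormal {d : ℕ} (T S : Finset (Space d)) (n : Space d) : Prop :=
  ‖n‖ = 1 ∧ ∀ x ∈ S, ∀ y ∈ T, inner ℝ n (y - x) ≤ 0

/-- The mean value over a side with respect to the `(d-1)`-dimensional Hausdorff measure. -/
def sideMean {d : ℕ} (S : Finset (Space d)) (g : Space d → Space d) : Space d :=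
  ⨍ x in hull S, g x ∂(Measure.hausdorffMeasure ((d : ℝ) - 1))

namespace Triangulation

variable {d : ℕ} {Ω : Set (Space d)} (𝒯 : Triangulation d Ω)

/-- `S` is the interior side `T ∩ T'` (of dimension `d - 1`). -/
def IsInteriorSide (S : Finset (Space d)) (T T' : 𝒯.cells) : Prop :=
  S.card = d ∧ T ≠ T' ∧ (S : Set (Space d)) = (T.1 : Set (Space d)) ∩ (T'.1 : Set (Space d))

/-- `S` is a side of `T` that lies in `∂Ω`. -/
def IsBoundarySide (S : Finset (Space d)) (T : 𝒯.cells) : Prop :=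
  S.card = d ∧ S ⊆ T.1 ∧ hull S ⊆ frontier Ω

/-- `S` is a boundary side of `T` whose (relative) interior lies in the boundary part `Γ`. -/
def IsBoundarySideIn (Γ : Set (Space d)) (S : Finset (Space d)) (T : 𝒯.cells) : Prop :=
  𝒯.IsBoundarySide S T ∧ intrinsicInterior ℝ (hull S) ⊆ Γ

/-- Every boundary side is a Dirichlet side or a Neumann side. -/
def Resolves (ΓD ΓN : Set (Space d)) : Prop :=
  ∀ S T, 𝒯.IsBoundarySide S T → 𝒯.IsBoundarySideIn ΓD S T ∨ 𝒯.IsBoundarySideIn ΓN S T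

/-! ### Element-wise polynomial fields

As all simplices are nondegenerate, a class in `L^∞(Ω)` whose restriction to each simplex is a
polynomial of degree at most `k` is the same as one such polynomial per simplex; equality a.e. in
`Ω` is equality on each simplex. Polynomials of degree at most one are affine maps. -/

/-- Element-wise constant fields with values in `V`. -/
abbrev P0 (V : Type*) := 𝒯.cells → V

/-- Element-wise affine fields with values in `V`. -/
abbrev P1 (V : Type*) [AddCommGroup V] [Module ℝ V] := 𝒯.cells → (Space d →ᵃ[ℝ] V)

/-- The integral over `Ω` of an element-wise given function. -/
def integral (g : 𝒯.cells → Space d → ℝ) : ℝ := ∑ T, ∫ x in hull T.1, g T x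

/-- `(v, w)_Ω` for vector fields. -/
def ip (v w : 𝒯.cells → Space d → Space d) : ℝ :=
  𝒯.integral fun T x => inner ℝ (v T x) (w T x)

/-- `(A, B)_Ω` for element-wise constant tensor fields. -/
def ipT (A B : 𝒯.P0 (Tensor d)) : ℝ := 𝒯.integral fun T _ => frob (A T) (B T)

variable {𝒯}

/-- An element-wise constant vector field as a function on each element. -/
def cst (v : 𝒯.P0 (Space d)) : 𝒯.cells → Space d → Space d := fun T _ => v T

/-- An element-wise affine vector field as a function on each element. -/
def fn (v : 𝒯.P1 (Space d)) : 𝒯.cells → Space d → Space d := fun T x => v T x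

/-- The element-wise gradient `∇_h`. -/
def gradh (v : 𝒯.P1 (Space d)) : 𝒯.P0 (Tensor d) := fun T => grad (v T)

/-- The element-wise divergence `div_h` of vector fields. -/
def divh (v : 𝒯.P1 (Space d)) : 𝒯.P0 ℝ := fun T => vdiv (v T)

/-- The row-wise divergence of element-wise affine tensor fields. (For a field with continuous
normal components, this is the divergence in the sense of distributions.) -/
def tdivh (τ : 𝒯.P1 (Tensor d)) : 𝒯.P0 (Space d) := fun T => tdiv (τ T)

/-- The projection `Π_h` of vector fields onto element-wise constants, by mean values. -/
def proj (v : 𝒯.cells → Space d → Space d) : 𝒯.P0 (Space d) := fun T => ⨍ x in hull T.1, v T x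

/-- The projection `Π_h` of tensor fields onto element-wise constants, by mean values. -/
def projT (τ : 𝒯.P1 (Tensor d)) : 𝒯.P0 (Tensor d) :=
  fun T => Matrix.of fun i j => ⨍ x in hull T.1, τ T x i j

/-- The element-wise deviatoric part. -/
def devh (A : 𝒯.P0 (Tensor d)) : 𝒯.P0 (Tensor d) := fun T => dev (A T)

/-- The field `id - Π_h id`. -/
def idSub (T : 𝒯.cells) (x : Space d) : Space d := x - proj (𝒯 := 𝒯) (fun _ y => y) T

/-- `τ - F` for an element-wise affine `τ` and an element-wise constant `F`. -/
def subConst (τ : 𝒯.P1 (Tensor d)) (F : 𝒯.P0 (Tensor d)) : 𝒯.P1 (Tensor d) :=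
  fun T => τ T - AffineMap.const ℝ (Space d) (F T)

/-! ### Crouzeix--Raviart and Raviart--Thomas spaces -/

/-- The Crouzeix--Raviart space: jumps across interior sides have mean value zero. -/
def IsCR (v : 𝒯.P1 (Space d)) : Prop :=
  ∀ S T T', 𝒯.IsInteriorSide S T T' → sideMean S (fun x => v T x - v T' x) = 0

/-- The Crouzeix--Raviart space with vanishing mean values on the Dirichlet sides. -/
def IsCRD (ΓD : Set (Space d)) (v : 𝒯.P1 (Space d)) : Prop :=
  IsCR v ∧ ∀ S T, 𝒯.IsBoundarySideIn ΓD S T → sideMean S (v T) = 0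

/-- The Raviart--Thomas space (row-wise, lowest order): the normal components are constant on each
side of each simplex and continuous across interior sides. -/
def IsRT (τ : 𝒯.P1 (Tensor d)) : Prop :=
  (∀ (T : 𝒯.cells) (S : Finset (Space d)) (n : Space d), S ⊆ T.1 → S.card = d →
    IsOuterNormal T.1 S n → ∀ x ∈ hull S, ∀ y ∈ hull S, act (τ T x) n = act (τ T y) n) ∧
  (∀ S T T', 𝒯.IsInteriorSide S T T' → ∀ n n', IsOuterNormal T.1 S n → IsOuterNormal T'.1 S n' →
    ∀ x ∈ hull S, act (τ T x) n + act (τ T' x) n' = 0)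

/-- The Raviart--Thomas space with vanishing normal components on the Neumann sides. -/
def IsRTN (ΓN : Set (Space d)) (τ : 𝒯.P1 (Tensor d)) : Prop :=
  IsRT τ ∧ ∀ S T, 𝒯.IsBoundarySideIn ΓN S T → ∀ n, IsOuterNormal T.1 S n →
    ∀ x ∈ hull S, act (τ T x) n = 0

/-! ### The discrete primal and dual Stokes problems -/

open Classical in
/-- The discrete primal energy functional `I_h`. -/
def primalEnergy (ν : ℝ) (f : 𝒯.P0 (Space d)) (F : 𝒯.P0 (Tensor d)) (uD v : 𝒯.P1 (Space d)) :
    EReal :=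
  if divh v = 0 then
    ((ν / 2 * 𝒯.ipT (gradh (v + uD)) (gradh (v + uD)) - 𝒯.ip (cst f) (cst (proj (fn v)))
      - 𝒯.ipT F (gradh v) : ℝ) : EReal)
  else ⊤

/-- `u` is a discrete primal solution: an element of `K_u^h` that minimises `I_h` over the
Crouzeix--Raviart space with homogeneous Dirichlet condition. -/
def IsPrimalSolution (ΓD : Set (Space d)) (ν : ℝ) (f : 𝒯.P0 (Space d)) (F : 𝒯.P0 (Tensor d))
    (uD u : 𝒯.P1 (Space d)) : Prop :=
  IsCRD ΓD u ∧ divh u = 0 ∧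
    ∀ v, IsCRD ΓD v → primalEnergy ν f F uD u ≤ primalEnergy ν f F uD v

open Classical in
/-- The discrete dual energy functional `D_h`. -/
def dualEnergy (ν : ℝ) (f : 𝒯.P0 (Space d)) (F : 𝒯.P0 (Tensor d)) (uD : 𝒯.P1 (Space d))
    (τ : 𝒯.P1 (Tensor d)) : EReal :=
  if tdivh (subConst τ F) = -f then
    ((-(1 / (2 * ν)) * 𝒯.ipT (devh (projT τ)) (devh (projT τ))
      + 𝒯.ipT (devh (projT τ)) (gradh uD) : ℝ) : EReal)
  else ⊥

/-- The set `K_T^h` of admissible discrete stresses: `τ - F_h` lies in the Raviart--Thomas space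
with homogeneous Neumann condition and `div (τ - F_h) = -f_h`. -/
def IsAdmissibleStress (ΓN : Set (Space d)) (f : 𝒯.P0 (Space d)) (F : 𝒯.P0 (Tensor d))
    (τ : 𝒯.P1 (Tensor d)) : Prop :=
  IsRTN ΓN (subConst τ F) ∧ tdivh (subConst τ F) = -f

/-- `τ` is a discrete dual solution: an element of `K_T^h` that maximises `D_h` over all `σ` for
which `σ - F_h` lies in the Raviart--Thomas space with homogeneous Neumann condition. -/
def IsDualSolution (ΓN : Set (Space d)) (ν : ℝ) (f : 𝒯.P0 (Space d)) (F : 𝒯.P0 (Tensor d))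
    (uD : 𝒯.P1 (Space d)) (τ : 𝒯.P1 (Tensor d)) : Prop :=
  IsAdmissibleStress ΓN f F τ ∧
    ∀ σ, IsRTN ΓN (subConst σ F) → dualEnergy ν f F uD σ ≤ dualEnergy ν f F uD τ

/-- `p` is a discrete pressure belonging to the velocity `u`. -/
def IsPressure (ΓD : Set (Space d)) (ν : ℝ) (f : 𝒯.P0 (Space d)) (F : 𝒯.P0 (Tensor d))
    (uD u : 𝒯.P1 (Space d)) (p : 𝒯.P0 ℝ) : Prop :=
  ∀ v, IsCRD ΓD v →
    𝒯.ipT (fun T => ν • gradh (u + uD) T - p T • (1 : Tensor d)) (gradh v)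
      = 𝒯.ip (cst f) (fn v) + 𝒯.ipT F (gradh v)

/-- `w` is an element-wise constant Lagrange multiplier belonging to the stress `τ`. -/
def IsMultiplier (ΓN : Set (Space d)) (ν : ℝ) (uD : 𝒯.P1 (Space d)) (τ : 𝒯.P1 (Tensor d))
    (w : 𝒯.P0 (Space d)) : Prop :=
  ∀ σ, IsRTN ΓN σ →
    -(1 / ν) * 𝒯.ipT (devh (projT τ)) (devh (projT σ)) - 𝒯.ip (cst w) (cst (tdivh σ))
      = -𝒯.ipT (gradh uD) (devh (projT σ))

end Triangulation

end StokesCR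

end

/-! The engine is discrete integration by parts: `(Π_h τ, ∇_h v) + (div τ, Π_h v) = 0` for
Raviart–Thomas `τ` vanishing on Neumann sides and Crouzeix–Raviart `v` vanishing on Dirichlet sides
(`pairing_eq_zero`). It has two converses, obtained by testing with fields supported on one side: a
field of Raviart–Thomas shape orthogonal to `V_D^h` lies in `Σ_N^h` (`isRTN_of_pairing_eq_zero`),
and an element-wise affine field orthogonal to `Σ_N^h` lies in `V_D^h` (`isCRD_of_pairing_eq_zero`).
The pressure equation and the multiplier equation are exactly these orthogonalities for `T_h - F_h`
and for `u_h`, so both reconstructions are admissible.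

In both parts the construction also gives `dev Π_h T_h = ν ∇_h(u_h + û_D)`. With this relation the
first-order term of either energy is an instance of integration by parts, and only a square remains:
`I_h(v) = I_h(u_h) + ν/2 ‖∇_h(v - u_h)‖²` and `D_h(σ) = D_h(T_h) - 1/(2ν) ‖dev Π_h(σ - T_h)‖²`
(`primalValue_eq`, `dualValue_eq`). Optimality is immediate. Uniqueness is the rigidity of the null
spaces: a field in `V_D^h` with zero gradient vanishes, and a divergence-free field in `Σ_N^h` with
zero deviatoric mean is a constant multiple of `I`, zero if there is a Neumann side.

The mean of an affine function over a simplex or a side is its value at the barycentre, so all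
integrals become point values and a Crouzeix–Raviart field is one that is continuous at side
centroids. Normals are multiples of gradients of barycentric coordinates `λ_P`, and `|T| ∇λ_P`
changes sign across a common side.

Rigidity and the treatment of the boundary need the topology of the mesh: a side is shared by at
most two simplices, every side is interior or lies in `∂Ω`, simplices are connected through interior
sides, and boundary sides cover `∂Ω`. The last two follow by moving along a segment that avoids all
faces of codimension two. -/

noncomputable section

namespace StokesCR

/-! ### Mean values of affine functions over simplices -/

section MeanValue

variable {V : Type*} [NormedAddCommGroup V] [NormedSpace ℝ V] {ι : Type*} [Fintype ι]

/-- The affine map with linear part `w ↦ w + f(w) u` fixing the zero set of the affine function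
`f`. -/
def affineTransvection (f : V →ᵃ[ℝ] ℝ) (u : V) : V →ᵃ[ℝ] V where
  toFun x := x + f x • u
  linear := LinearMap.transvection f.linear u
  map_vadd' p v := by
    have h := f.map_vadd p v
    simp only [vadd_eq_add] at h
    simp only [vadd_eq_add, h, LinearMap.transvection.apply, add_smul]
    abel

theorem affineTransvection_apply (f : V →ᵃ[ℝ] ℝ) (u x : V) :
    affineTransvection f u x = x + f x • u := rfl

theorem affineMap_apply_eq_sum_coord {F : Type*} [AddCommGroup F] [Module ℝ F]
    (b : AffineBasis ι ℝ V) (g : V →ᵃ[ℝ] F) (x : V) : g x = ∑ i, b.coord i x • g (b i) := by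
  conv_lhs => rw [← b.affineCombination_coord_eq_self x]
  rw [Finset.map_affineCombination _ _ _ (b.sum_coord_apply_eq_one x),
    Finset.affineCombination_eq_linear_combination _ _ _ (b.sum_coord_apply_eq_one x)]
  rfl

theorem isCompact_convexHull_range (b : AffineBasis ι ℝ V) :
    IsCompact (convexHull ℝ (Set.range b)) :=
  (Set.finite_range b).isCompact_convexHull ℝ

variable [FiniteDimensional ℝ V]

theorem det_affineTransvection (f : V →ᵃ[ℝ] ℝ) (u : V) :
    LinearMap.det (affineTransvection f u).linear = 1 + f.linear u :=
  LinearMap.transvection.det _ _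

theorem addHaar_image_affineMap [MeasurableSpace V] [BorelSpace V] (μ : Measure V)
    [μ.IsAddHaarMeasure] (φ : V →ᵃ[ℝ] V) (s : Set V) :
    μ (φ '' s) = ENNReal.ofReal |LinearMap.det φ.linear| * μ s := by
  have h : φ '' s = (fun x => φ 0 + x) '' (φ.linear '' s) := by
    rw [Set.image_image]
    refine Set.image_congr fun x _ => ?_
    have := φ.map_vadd 0 x
    simp only [vadd_eq_add, add_zero] at this
    rw [this, add_comm]
  rw [h, ← Measure.addHaar_image_linearMap, Set.image_add_left, measure_preimage_add]

theorem integrableOn_affineMap [MeasurableSpace V] [BorelSpace V] (μ : Measure V)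
    [IsFiniteMeasureOnCompacts μ] {F : Type*} [NormedAddCommGroup F] [NormedSpace ℝ F]
    (g : V →ᵃ[ℝ] F) {s : Set V} (hs : IsCompact s) : IntegrableOn g s μ :=
  (AffineMap.continuous_of_finiteDimensional g).continuousOn.integrableOn_compact hs

theorem measure_convexHull_ne_zero [MeasurableSpace V] [BorelSpace V] (μ : Measure V)
    [μ.IsAddHaarMeasure] {ι' : Type*} (b : AffineBasis ι' ℝ V) :
    μ (convexHull ℝ (Set.range b)) ≠ 0 := by
  have : (interior (convexHull ℝ (Set.range b))).Nonempty := by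
    rw [interior_convexHull_nonempty_iff_affineSpan_eq_top]; exact b.tot
  exact (Measure.measure_pos_of_nonempty_interior μ this).ne'

/-- The affine involution that swaps the vertices `b i` and `b j` and fixes the others has
determinant `-1`, hence preserves the measure; it maps the simplex to itself and swaps the two
coordinates. -/
theorem setIntegral_coord_eq [MeasurableSpace V] [BorelSpace V] (μ : Measure V)
    [μ.IsAddHaarMeasure] (b : AffineBasis ι ℝ V) (i j : ι) :
    ∫ x in convexHull ℝ (Set.range b), b.coord i x ∂μ
      = ∫ x in convexHull ℝ (Set.range b), b.coord j x ∂μ := by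
  classical
  by_cases hij : i = j
  · rw [hij]
  set K := convexHull ℝ (Set.range b) with hK
  set φ := affineTransvection (b.coord i - b.coord j) (b j - b i) with hφ
  have hφx : ∀ x, φ x = x + (b.coord i x - b.coord j x) • (b j - b i) := fun x => rfl
  have hci : ∀ k x, b.coord k (φ x) = b.coord (Equiv.swap i j k) x := by
    intro k x
    have h1 : φ x = (b.coord i x - b.coord j x) • (b j -ᵥ b i) +ᵥ x := by
      rw [hφx, vadd_eq_add, vsub_eq_sub, add_comm]
    rw [h1, AffineMap.map_vadd, map_smul, AffineMap.linearMap_vsub, b.coord_apply, b.coord_apply]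
    simp only [vadd_eq_add, vsub_eq_sub, smul_eq_mul]
    by_cases hki : k = i
    · subst hki; simp [hij]
    · by_cases hkj : k = j
      · subst hkj; simp [hki]
      · simp [hki, hkj, Equiv.swap_apply_of_ne_of_ne]
  have hdet : LinearMap.det φ.linear = -1 := by
    rw [hφ, det_affineTransvection, ← vsub_eq_sub (b j) (b i), AffineMap.linearMap_vsub]
    simp [b.coord_apply, hij, Ne.symm hij]
  have hinv : ∀ x, φ (φ x) = x := by
    intro x
    refine b.ext_elem fun k => ?_
    rw [hci, hci, Equiv.swap_apply_self]
  have hcont : Continuous φ := AffineMap.continuous_of_finiteDimensional φ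
  have hmp : MeasurePreserving φ μ μ := by
    refine ⟨hcont.measurable, ?_⟩
    ext s hs
    have : φ ⁻¹' s = φ '' s := by
      ext x
      constructor
      · intro hx; exact ⟨φ x, hx, hinv x⟩
      · rintro ⟨y, hy, rfl⟩; simpa [hinv] using hy
    rw [Measure.map_apply hcont.measurable hs, this, addHaar_image_affineMap, hdet]
    simp
  have hemb : MeasurableEmbedding φ :=
    (Homeomorph.mk ⟨φ, φ, hinv, hinv⟩ hcont hcont).measurableEmbedding
  have hpre : φ ⁻¹' K = K := by
    ext x
    simp only [hK, b.convexHull_eq_nonneg_coord, Set.mem_preimage, Set.mem_ofPred_eq, hci]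
    constructor
    · intro h k; simpa using h (Equiv.swap i j k)
    · intro h k; exact h _
  have := hmp.setIntegral_preimage_emb hemb (fun x => b.coord j x) K
  rw [hpre] at this
  rw [← this]
  simp [hci]

/-- The barycentric coordinates have equal integrals and sum to one. An arbitrary Haar measure is
allowed so that the formula serves both for volumes and for Hausdorff measure on sides. -/
theorem setAverage_affineMap [MeasurableSpace V] [BorelSpace V] (μ : Measure V)
    [μ.IsAddHaarMeasure] {F : Type*} [NormedAddCommGroup F] [NormedSpace ℝ F] [CompleteSpace F]
    (b : AffineBasis ι ℝ V) (g : V →ᵃ[ℝ] F) :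
    ⨍ x in convexHull ℝ (Set.range b), g x ∂μ = (Fintype.card ι : ℝ)⁻¹ • ∑ i, g (b i) := by
  set K := convexHull ℝ (Set.range b) with hK
  have hKc : IsCompact K := isCompact_convexHull_range b
  have h0 : μ.real K ≠ 0 :=
    (ENNReal.toReal_pos (measure_convexHull_ne_zero μ b) hKc.measure_lt_top.ne).ne'
  have hn : (Fintype.card ι : ℝ) ≠ 0 := by
    have := b.nonempty
    exact_mod_cast Fintype.card_ne_zero
  have hint : ∀ i, ∫ x in K, b.coord i x ∂μ = μ.real K * (Fintype.card ι : ℝ)⁻¹ := by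
    intro i
    have h1 : ∑ j, ∫ x in K, b.coord j x ∂μ = μ.real K := by
      rw [← integral_finsetSum _ fun j _ => integrableOn_affineMap μ _ hKc]
      simp [b.sum_coord_apply_eq_one]
    rw [Finset.sum_congr rfl fun j _ => setIntegral_coord_eq μ b j i] at h1
    simp only [Finset.sum_const, Finset.card_univ, nsmul_eq_mul] at h1
    field_simp
    linarith
  rw [setAverage_eq, setIntegral_congr_fun hKc.measurableSet
    fun x _ => affineMap_apply_eq_sum_coord b g x, integral_finsetSum _ fun j _ =>
      Integrable.smul_const (integrableOn_affineMap μ (b.coord j) hKc) (g (b j))]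
  simp_rw [integral_smul_const, hint]
  rw [Finset.smul_sum, Finset.smul_sum]
  refine Finset.sum_congr rfl fun i _ => ?_
  rw [smul_smul, ← mul_assoc, inv_mul_cancel₀ h0, one_mul]

end MeanValue

end StokesCR
end

noncomputable section

namespace StokesCR

open scoped Classical

variable {d : ℕ} {T S : Finset (Space d)} {P Q x : Space d}

/-! ### Barycentric coordinates of a simplex -/

/-- The finite set `T` is the vertex set of a nondegenerate simplex in `ℝ^d`. -/
structure IsSimplex (T : Finset (Space d)) : Prop where
  card_eq : T.card = d + 1
  indep : AffineIndependent ℝ ((↑) : T → Space d)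

/-- The vertices of a nondegenerate simplex as an affine basis. -/
def IsSimplex.basis (hT : IsSimplex T) : AffineBasis T ℝ (Space d) :=
  ⟨(↑), hT.indep, by
    rw [hT.indep.affineSpan_eq_top_iff_card_eq_finrank_add_one]
    simp [hT.card_eq]⟩

theorem IsSimplex.basis_apply (hT : IsSimplex T) (P : T) : hT.basis P = P := rfl

theorem IsSimplex.range_basis (hT : IsSimplex T) : Set.range hT.basis = (T : Set (Space d)) :=
  Subtype.range_coe

/-- The barycentric coordinate of the vertex `P` of the simplex `T`. -/
def bary (T : Finset (Space d)) (P : Space d) : Space d →ᵃ[ℝ] ℝ :=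
  if h : IsSimplex T ∧ P ∈ T then h.1.basis.coord ⟨P, h.2⟩ else 0

/-- The gradient of the barycentric coordinate of the vertex `P` of the simplex `T`. -/
def baryGrad (T : Finset (Space d)) (P : Space d) : Space d :=
  (InnerProductSpace.toDual ℝ (Space d)).symm (LinearMap.toContinuousLinearMap (bary T P).linear)

/-- The arithmetic mean of a finite set of points. -/
def centroid (S : Finset (Space d)) : Space d := (S.card : ℝ)⁻¹ • ∑ Q ∈ S, Q

/-- The volume of a simplex. -/
def vol (T : Finset (Space d)) : ℝ := volume.real (hull T)

theorem inner_baryGrad (T : Finset (Space d)) (P h : Space d) :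
    inner ℝ (baryGrad T P) h = (bary T P).linear h := by
  simp [baryGrad]

theorem inner_baryGrad_sub (T : Finset (Space d)) (P x y : Space d) :
    inner ℝ (baryGrad T P) (x - y) = bary T P x - bary T P y := by
  rw [inner_baryGrad, ← vsub_eq_sub x y, AffineMap.linearMap_vsub, vsub_eq_sub]

namespace IsSimplex

theorem bary_eq (hT : IsSimplex T) (hP : P ∈ T) : bary T P = hT.basis.coord ⟨P, hP⟩ := by
  simp [bary, hT, hP]

theorem bary_apply (hT : IsSimplex T) (hP : P ∈ T) (hQ : Q ∈ T) :
    bary T P Q = if P = Q then 1 else 0 := by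
  rw [hT.bary_eq hP]
  have := hT.basis.coord_apply ⟨P, hP⟩ ⟨Q, hQ⟩
  rw [hT.basis_apply] at this
  simpa using this

theorem bary_self (hT : IsSimplex T) (hP : P ∈ T) : bary T P P = 1 := by
  simp [hT.bary_apply hP hP]

theorem bary_ne (hT : IsSimplex T) (hP : P ∈ T) (hQ : Q ∈ T) (h : P ≠ Q) : bary T P Q = 0 := by
  simp [hT.bary_apply hP hQ, h]

theorem sum_bary (hT : IsSimplex T) (x : Space d) : ∑ P ∈ T, bary T P x = 1 := by
  rw [← hT.basis.sum_coord_apply_eq_one x, ← Finset.sum_coe_sort]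
  exact Finset.sum_congr rfl fun P _ => by rw [hT.bary_eq P.2]

theorem affineMap_apply (hT : IsSimplex T) {F : Type*} [AddCommGroup F] [Module ℝ F]
    (g : Space d →ᵃ[ℝ] F) (x : Space d) : g x = ∑ P ∈ T, bary T P x • g P := by
  rw [affineMap_apply_eq_sum_coord hT.basis,
    ← Finset.sum_coe_sort T fun P => bary T P x • g P]
  exact Finset.sum_congr rfl fun P _ => by rw [hT.bary_eq P.2, hT.basis_apply]

theorem affineMap_ext (hT : IsSimplex T) {F : Type*} [AddCommGroup F] [Module ℝ F]
    {g g' : Space d →ᵃ[ℝ] F} (h : ∀ P ∈ T, g P = g' P) : g = g' := by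
  ext x
  rw [hT.affineMap_apply g, hT.affineMap_apply g']
  exact Finset.sum_congr rfl fun P hP => by rw [h P hP]

theorem mem_hull_iff (hT : IsSimplex T) : x ∈ hull T ↔ ∀ P ∈ T, 0 ≤ bary T P x := by
  rw [hull, ← hT.range_basis, hT.basis.convexHull_eq_nonneg_coord]
  constructor
  · intro h P hP
    rw [hT.bary_eq hP]
    exact h _
  · intro h P
    rw [← hT.bary_eq P.2]
    exact h P P.2

theorem mem_interior_hull_iff (hT : IsSimplex T) :
    x ∈ interior (hull T) ↔ ∀ P ∈ T, 0 < bary T P x := by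
  rw [hull, ← hT.range_basis, hT.basis.interior_convexHull]
  constructor
  · intro h P hP
    rw [hT.bary_eq hP]
    exact h _
  · intro h P
    rw [← hT.bary_eq P.2]
    exact h P P.2

/-- Faces are cut out by vanishing barycentric coordinates; in this form the conformity condition
`inter_subset` becomes usable. -/
theorem mem_convexHull_iff_of_subset (hT : IsSimplex T) {R : Finset (Space d)} (hR : R ⊆ T) :
    x ∈ hull R ↔ x ∈ hull T ∧ ∀ P ∈ T, P ∉ R → bary T P x = 0 := by
  constructor
  · intro hx
    refine ⟨convexHull_mono (by exact_mod_cast hR) hx, fun P hP hPR => ?_⟩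
    have hsub : hull R ⊆ (bary T P) ⁻¹' {0} := by
      refine convexHull_min ?_ ((convex_singleton 0).affine_preimage (bary T P))
      intro Q hQ
      have hQ' : Q ∈ R := hQ
      exact hT.bary_ne hP (hR hQ') (fun h => hPR (h ▸ hQ'))
    exact hsub hx
  · rintro ⟨hx, h0⟩
    have hx' := hT.affineMap_apply (AffineMap.id ℝ (Space d)) x
    simp only [AffineMap.id_apply] at hx'
    have h1 := hT.sum_bary x
    rw [← Finset.sum_subset hR fun P hP hPR => by rw [h0 P hP hPR, zero_smul]] at hx'
    rw [← Finset.sum_subset hR fun P hP hPR => h0 P hP hPR] at h1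
    rw [hx']
    exact (convex_convexHull ℝ _).sum_mem (fun P hP => hT.mem_hull_iff.1 hx P (hR hP)) h1
      fun P hP => subset_convexHull ℝ _ hP

theorem bary_nonneg (hT : IsSimplex T) (hx : x ∈ hull T) (hP : P ∈ T) : 0 ≤ bary T P x :=
  hT.mem_hull_iff.1 hx P hP

theorem isCompact_hull (T : Finset (Space d)) : IsCompact (hull T) :=
  T.finite_toSet.isCompact_convexHull ℝ

theorem vol_pos (hT : IsSimplex T) : 0 < vol T := by
  have h : volume (hull T) ≠ 0 := by
    rw [hull, ← hT.range_basis]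
    exact measure_convexHull_ne_zero volume hT.basis
  exact ENNReal.toReal_pos h (isCompact_hull T).measure_lt_top.ne

end IsSimplex

theorem affineMap_centroid (hS : S.Nonempty) {F : Type*} [AddCommGroup F] [Module ℝ F]
    (g : Space d →ᵃ[ℝ] F) : g (centroid S) = (S.card : ℝ)⁻¹ • ∑ Q ∈ S, g Q := by
  have hc : (S.card : ℝ) ≠ 0 := by exact_mod_cast hS.card_pos.ne'
  have hg : ∀ x, g x = g.linear x + g 0 := fun x => by
    simpa using g.map_vadd 0 x
  rw [hg, centroid, map_smul, map_sum, Finset.sum_congr rfl fun Q _ => hg Q, Finset.sum_add_distrib,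
    Finset.sum_const, ← Nat.cast_smul_eq_nsmul ℝ, smul_add, smul_smul, inv_mul_cancel₀ hc, one_smul]

theorem centroid_mem_hull (hS : S.Nonempty) : centroid S ∈ hull S := by
  have hc : (S.card : ℝ) ≠ 0 := by exact_mod_cast hS.card_pos.ne'
  rw [centroid, Finset.smul_sum]
  refine (convex_convexHull ℝ _).sum_mem (fun _ _ => by positivity) ?_
    fun P hP => subset_convexHull ℝ _ hP
  simp [hc]

namespace IsSimplex

theorem nonempty (hT : IsSimplex T) : T.Nonempty := by
  rw [← Finset.card_pos, hT.card_eq]; omega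

theorem card_erase (hT : IsSimplex T) (hP : P ∈ T) : (T.erase P).card = d := by
  rw [Finset.card_erase_of_mem hP, hT.card_eq]; rfl

theorem erase_nonempty (hT : IsSimplex T) (hd : d ≠ 0) (hP : P ∈ T) : (T.erase P).Nonempty := by
  rw [← Finset.card_pos, hT.card_erase hP]; omega

theorem bary_centroid (hT : IsSimplex T) (hP : P ∈ T) :
    bary T P (centroid T) = ((d : ℝ) + 1)⁻¹ := by
  rw [affineMap_centroid hT.nonempty, Finset.sum_congr rfl fun Q hQ => hT.bary_apply hP hQ,
    Finset.sum_ite_eq, if_pos hP, hT.card_eq]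
  simp

theorem bary_centroid_erase (hT : IsSimplex T) (hd : d ≠ 0) (hP : P ∈ T) (hQ : Q ∈ T) :
    bary T P (centroid (T.erase Q)) = if P = Q then 0 else (d : ℝ)⁻¹ := by
  rw [affineMap_centroid (hT.erase_nonempty hd hQ), hT.card_erase hQ,
    Finset.sum_congr rfl fun R hR => hT.bary_apply hP (Finset.mem_of_mem_erase hR),
    Finset.sum_ite_eq]
  by_cases h : P = Q <;> simp [h, hP]

theorem bary_eq_zero_of_mem_side (hT : IsSimplex T) (hP : P ∈ T) (hx : x ∈ hull (T.erase P)) :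
    bary T P x = 0 :=
  ((hT.mem_convexHull_iff_of_subset (T.erase_subset P)).1 hx).2 P hP (by simp)

/-- Through this `Π_h` becomes evaluation at the centroid, and the measure theory on simplices
disappears. -/
theorem setAverage_hull (hT : IsSimplex T) {F : Type*} [NormedAddCommGroup F] [NormedSpace ℝ F]
    [CompleteSpace F] (g : Space d →ᵃ[ℝ] F) : ⨍ x in hull T, g x = g (centroid T) := by
  rw [hull, ← hT.range_basis, setAverage_affineMap, affineMap_centroid hT.nonempty,
    Fintype.card_coe, ← Finset.sum_coe_sort T fun P => g P]
  rfl

theorem baryGrad_ne_zero (hT : IsSimplex T) (hd : d ≠ 0) (hP : P ∈ T) : baryGrad T P ≠ 0 := by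
  intro h
  obtain ⟨Q, hQ⟩ := hT.erase_nonempty hd hP
  have := inner_baryGrad_sub T P P Q
  rw [h, inner_zero_left, hT.bary_self hP,
    hT.bary_ne hP (Finset.mem_of_mem_erase hQ) (Finset.ne_of_mem_erase hQ).symm] at this
  norm_num at this

/-- The outer unit normal on the side opposite to `P` is `-∇λ_P / |∇λ_P|`. -/
theorem isOuterNormal_iff (hT : IsSimplex T) (hd : d ≠ 0) (hP : P ∈ T) (n : Space d) :
    IsOuterNormal T (T.erase P) n ↔ n = -(‖baryGrad T P‖⁻¹ • baryGrad T P) := by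
  have hg := hT.baryGrad_ne_zero hd hP
  have hg' : ‖baryGrad T P‖ ≠ 0 := norm_ne_zero_iff.2 hg
  constructor
  · rintro ⟨hn, h⟩
    obtain ⟨Q, hQ⟩ := hT.erase_nonempty hd hP
    have hQT := Finset.mem_of_mem_erase hQ
    -- Two points of the side can play either role in the defining inequality, so `n` is orthogonal
    -- to the side.
    have heq : ∀ R ∈ T.erase P, inner ℝ n (R - Q) = 0 := by
      intro R hR
      refine le_antisymm (h Q hQ R (Finset.mem_of_mem_erase hR)) ?_
      have := h R hR Q hQT
      rw [← neg_sub, inner_neg_right] at this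
      linarith
    -- As `n` annihilates the directions of the side, expanding in barycentric coordinates leaves
    -- only the term of `P`.
    have hn' : n = inner ℝ n (P - Q) • baryGrad T P := by
      refine ext_inner_right ℝ fun v => ?_
      have h1 : inner ℝ n v = inner ℝ n ((v + Q) - Q) := by simp
      have h2 := hT.affineMap_apply
        ((innerₛₗ ℝ n).toAffineMap.comp (AffineMap.id ℝ (Space d) - AffineMap.const ℝ (Space d) Q))
        (v + Q)
      simp only [AffineMap.comp_apply, AffineMap.coe_sub, Pi.sub_apply, AffineMap.id_apply,
        AffineMap.const_apply, LinearMap.coe_toAffineMap, innerₛₗ_apply_apply, smul_eq_mul] at h2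
      rw [h1, h2, ← Finset.add_sum_erase _ _ hP,
        Finset.sum_eq_zero fun R hR => by rw [heq R hR, mul_zero], add_zero,
        inner_smul_left, inner_baryGrad, mul_comm]
      have h3 : bary T P (v + Q) = (bary T P).linear v := by
        have := (bary T P).map_vadd Q v
        rw [vadd_eq_add] at this
        rw [this, hT.bary_ne hP hQT (Finset.ne_of_mem_erase hQ).symm]
        simp
      rw [h3]
      rfl
    -- Outwardness fixes the sign of the factor and `‖n‖ = 1` its modulus.
    have hle := h Q hQ P hP
    set c := inner ℝ n (P - Q) with hc
    have hcn : |c| * ‖baryGrad T P‖ = 1 := by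
      rw [← hn]; conv_rhs => rw [hn']
      rw [norm_smul, Real.norm_eq_abs]
    rw [abs_of_nonpos hle] at hcn
    have : c = -‖baryGrad T P‖⁻¹ := by
      field_simp; linarith
    rw [hn', this, neg_smul]
  · rintro rfl
    refine ⟨by rw [norm_neg, norm_smul, norm_inv, norm_norm, inv_mul_cancel₀ hg'], ?_⟩
    intro x hx y hy
    rw [inner_neg_left, inner_smul_left, inner_baryGrad_sub,
      hT.bary_ne hP (Finset.mem_of_mem_erase hx) (Finset.ne_of_mem_erase hx).symm,
      hT.bary_apply hP hy]
    have : 0 ≤ ‖baryGrad T P‖⁻¹ := by positivity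
    simp only [conj_trivial]
    split_ifs <;> simp

end IsSimplex

/-! ### Sides -/

theorem finrank_vectorSpan_finset {n : ℕ} (hS : S.card = n + 1)
    (hi : AffineIndependent ℝ ((↑) : S → Space d)) :
    Module.finrank ℝ (vectorSpan ℝ (S : Set (Space d))) = n := by
  have h := hi.finrank_vectorSpan (n := n) (by simp [hS])
  have e : Set.range ((↑) : S → Space d) = (S : Set (Space d)) := Subtype.range_coe
  exact e ▸ h

/-- A set of affinely independent points, parametrised by the direction of its affine span. -/
theorem exists_affineIsometry_basis (hS : S.Nonempty)
    (hi : AffineIndependent ℝ ((↑) : S → Space d)) :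
    ∃ (φ : vectorSpan ℝ (S : Set (Space d)) →ᵃⁱ[ℝ] Space d)
      (b : AffineBasis S ℝ (vectorSpan ℝ (S : Set (Space d)))), ∀ Q, φ (b Q) = Q := by
  obtain ⟨p, hp⟩ := hS
  let W := vectorSpan ℝ (S : Set (Space d))
  let b0 : S → W := fun Q => ⟨Q - p, vsub_mem_vectorSpan ℝ Q.2 hp⟩
  let φ : W →ᵃⁱ[ℝ] Space d :=
    (AffineIsometryEquiv.vaddConst ℝ p).toAffineIsometry.comp W.subtypeₗᵢ.toAffineIsometry
  have hφ : ∀ Q, φ (b0 Q) = Q := fun Q => by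
    show ((Q : Space d) - p) +ᵥ p = Q
    simp
  have hcomp : (φ ∘ b0) = ((↑) : S → Space d) := funext hφ
  have hind : AffineIndependent ℝ b0 := by
    refine AffineIndependent.of_comp φ.toAffineMap ?_
    change AffineIndependent ℝ (φ ∘ b0)
    rw [hcomp]; exact hi
  have : Nonempty S := ⟨⟨p, hp⟩⟩
  refine ⟨φ, ⟨b0, hind, ?_⟩, hφ⟩
  rw [hind.affineSpan_eq_top_iff_card_eq_finrank_add_one]
  have hpos := Fintype.card_pos (α := S)
  have h := finrank_vectorSpan_finset (n := Fintype.card S - 1) (by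
    rw [← Fintype.card_coe]; omega) hi
  rw [h]
  omega

theorem image_hull_basis {W : Submodule ℝ (Space d)} (φ : W →ᵃⁱ[ℝ] Space d)
    (b : AffineBasis S ℝ W) (h : ∀ Q, φ (b Q) = Q) :
    φ '' (convexHull ℝ (Set.range b)) = hull S := by
  have := φ.toAffineMap.image_convexHull (Set.range b)
  rw [AffineIsometry.coe_toAffineMap] at this
  rw [this, ← Set.range_comp]
  congr 1
  have : (φ ∘ b) = ((↑) : S → Space d) := funext h
  rw [this]; exact Subtype.range_coe

/-- An isometry identifies the affine span of the side with its direction space, of dimension `d -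
1`, where the Hausdorff measure is a Haar measure; its normalisation cancels in the mean. -/
theorem sideMean_eq (hd : d ≠ 0) (hS : S.card = d) (hi : AffineIndependent ℝ ((↑) : S → Space d))
    (g : Space d →ᵃ[ℝ] Space d) : sideMean S g = g (centroid S) := by
  have hne : S.Nonempty := by rw [← Finset.card_pos]; omega
  obtain ⟨φ, b, hφ⟩ := exists_affineIsometry_basis hne hi
  have hdim : (Module.finrank ℝ (vectorSpan ℝ (S : Set (Space d))) : ℝ) = (d : ℝ) - 1 := by
    rw [finrank_vectorSpan_finset (n := d - 1) (by omega) hi, Nat.cast_sub (by omega), Nat.cast_one]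
  have hnn : (0 : ℝ) ≤ (d : ℝ) - 1 := by rw [← hdim]; positivity
  have hemb : MeasurableEmbedding φ := φ.isometry.isClosedEmbedding.measurableEmbedding
  have hmap := φ.isometry.map_hausdorffMeasure (d := (d : ℝ) - 1) (Or.inl hnn)
  have hK := image_hull_basis φ b hφ
  have hsub : hull S ⊆ Set.range φ := hK ▸ Set.image_subset_range _ _
  have hpre : φ ⁻¹' (hull S) = convexHull ℝ (Set.range b) := by
    rw [← hK, Set.preimage_image_eq _ φ.injective]
  have key : (Measure.hausdorffMeasure ((d : ℝ) - 1)).restrict (hull S)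
      = (((Measure.hausdorffMeasure ((d : ℝ) - 1)).restrict
          (convexHull ℝ (Set.range b))).map φ) := by
    rw [← hpre, ← hemb.restrict_map, hmap, Measure.restrict_restrict
      (IsSimplex.isCompact_hull S).measurableSet, Set.inter_eq_left.2 hsub]
  rw [sideMean, average_eq, key, hemb.integral_map, map_measureReal_apply hemb.measurable
    MeasurableSet.univ, Set.preimage_univ, ← average_eq]
  -- With the exponent written as a `finrank`, the Hausdorff measure is recognised as a Haar
  -- measure.
  rw [← hdim]
  have := setAverage_affineMap (Measure.hausdorffMeasure
    (Module.finrank ℝ (vectorSpan ℝ (S : Set (Space d))) : ℝ)) b (g.comp φ.toAffineMap)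
  simp only [AffineMap.comp_apply, AffineIsometry.coe_toAffineMap, hφ] at this
  rw [this, affineMap_centroid hne, Fintype.card_coe, Finset.sum_coe_sort S fun Q => g Q]

/-- The relative interior of a side is dense in the side. -/
theorem exists_mem_intrinsicInterior (hS : S.Nonempty)
    (hi : AffineIndependent ℝ ((↑) : S → Space d)) (hx : x ∈ hull S) {U : Set (Space d)}
    (hU : IsOpen U) (hxU : x ∈ U) : ∃ y ∈ U, y ∈ intrinsicInterior ℝ (hull S) := by
  obtain ⟨φ, b, hφ⟩ := exists_affineIsometry_basis hS hi
  have hK := image_hull_basis φ b hφ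
  rw [← hK] at hx ⊢
  obtain ⟨w, hw, rfl⟩ := hx
  have hint : (interior (convexHull ℝ (Set.range b))).Nonempty := by
    rw [interior_convexHull_nonempty_iff_affineSpan_eq_top]; exact b.tot
  have hcl := (convex_convexHull ℝ (Set.range b)).closure_interior_eq_closure_of_nonempty_interior
    hint
  have hw' : w ∈ closure (interior (convexHull ℝ (Set.range b))) := by
    rw [hcl]; exact subset_closure hw
  obtain ⟨y, hyU, hy⟩ := mem_closure_iff.1 hw' (φ ⁻¹' U) (hU.preimage φ.continuous) hxU
  refine ⟨φ y, hyU, ?_⟩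
  rw [AffineIsometry.intrinsicInterior_image]
  exact ⟨y, interior_subset_intrinsicInterior hy, rfl⟩

end StokesCR
end

/-! ### Lipschitz boundaries and general position -/

noncomputable section

namespace StokesCR

open scoped Classical

variable {d : ℕ} {Ω : Set (Space d)}

theorem continuous_affineMap {F : Type*} [NormedAddCommGroup F] [NormedSpace ℝ F]
    (g : Space d →ᵃ[ℝ] F) : Continuous g := AffineMap.continuous_of_finiteDimensional g

/-- A Lipschitz domain lies locally on one side of its boundary. -/
theorem IsLipschitzDomain.inter_compl_closure_nonempty (hΩ : IsLipschitzDomain Ω) {x : Space d}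
    (hx : x ∈ frontier Ω) {V : Set (Space d)} (hV : V ∈ 𝓝 x) : (V ∩ (closure Ω)ᶜ).Nonempty := by
  obtain ⟨n, φ, L, U, hU, hn, hφ, hg⟩ := hΩ.graph x hx
  have hxΩ : x ∉ Ω := by
    rw [hΩ.isOpen.frontier_eq] at hx; exact hx.2
  have h1 : inner ℝ n x ≤ φ (x - inner ℝ n x • n) :=
    not_lt.1 fun h => hxΩ ((hg x (mem_of_mem_nhds hU)).2 h)
  -- Going from `x` in direction `-n` keeps the coordinates orthogonal to `n` and moves strictly
  -- below the graph.
  have hlim : Filter.Tendsto (fun t : ℝ => x - t • n) (𝓝[>] 0) (𝓝 x) := by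
    have : Continuous fun t : ℝ => x - t • n := by fun_prop
    have h := this.tendsto 0
    simp only [zero_smul, sub_zero] at h
    exact h.mono_left nhdsWithin_le_nhds
  obtain ⟨t, ⟨htV, htU⟩, ht⟩ := ((hlim.eventually (Filter.eventually_mem_set.2
    (Filter.inter_mem hV (interior_mem_nhds.2 hU)))).and self_mem_nhdsWithin).exists
  have ht0 : 0 < t := ht
  refine ⟨x - t • n, htV, fun hcl => ?_⟩
  have hin : inner ℝ n (x - t • n) = inner ℝ n x - t := by
    rw [inner_sub_right, inner_smul_right, real_inner_self_eq_norm_sq, hn]; ring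
  have hcont : Continuous fun z : Space d => φ (z - inner ℝ n z • n) :=
    hφ.continuous.comp (by fun_prop)
  -- Lying strictly below the graph is an open condition, so such points are even outside `closure
  -- Ω`.
  have hopen : IsOpen (interior U ∩ {z | inner ℝ n z < φ (z - inner ℝ n z • n)}) :=
    isOpen_interior.inter (isOpen_lt (by fun_prop) hcont)
  obtain ⟨z, ⟨hzU, hz⟩, hzΩ⟩ := mem_closure_iff.1 hcl _ hopen ⟨htU, by
    show inner ℝ n (x - t • n) < φ (x - t • n - inner ℝ n (x - t • n) • n)
    have : x - t • n - inner ℝ n (x - t • n) • n = x - inner ℝ n x • n := by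
      rw [hin, sub_smul]; abel
    rw [this, hin]; linarith⟩
  exact absurd ((hg z (interior_subset hzU)).1 hzΩ) (not_lt.2 (le_of_lt hz))

/-- This excludes slits: without it a side shared by two simplices could lie in `∂Ω`. -/
theorem IsLipschitzDomain.notMem_frontier (hΩ : IsLipschitzDomain Ω) {x : Space d}
    (hx : x ∈ interior (closure Ω)) : x ∉ frontier Ω := fun h => by
  obtain ⟨y, hy, hy'⟩ := hΩ.inter_compl_closure_nonempty h (mem_interior_iff_mem_nhds.1 hx)
  exact hy' hy

/-! ### Segments in general position -/

theorem affineSpan_ne_top_of_card_le {R : Finset (Space d)} (hR : R.card ≤ d) :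
    affineSpan ℝ (R : Set (Space d)) ≠ ⊤ := by
  intro h
  rcases R.eq_empty_or_nonempty with rfl | hne
  · simp at h
  · have hpos := hne.card_pos
    have hd := finrank_vectorSpan_image_finset_le ℝ (id : Space d → Space d) R (n := R.card - 1)
      (by omega)
    rw [Finset.image_id, ← direction_affineSpan, h, AffineSubspace.direction_top, finrank_top,
      finrank_euclideanSpace_fin] at hd
    omega

/-- Finitely many proper affine subspaces form a null set and cannot cover a nonempty open set. -/
theorem exists_mem_notMem_affineSpan (𝓡 : Finset (Finset (Space d)))
    (hR : ∀ R ∈ 𝓡, R.card ≤ d) {V : Set (Space d)} (hV : IsOpen V) (hne : V.Nonempty) :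
    ∃ z ∈ V, ∀ R ∈ 𝓡, z ∉ affineSpan ℝ (R : Set (Space d)) := by
  by_contra! h
  have hsub : V ⊆ ⋃ R ∈ 𝓡, (affineSpan ℝ (R : Set (Space d)) : Set (Space d)) := fun z hz => by
    obtain ⟨R, hR, hzR⟩ := h z hz
    exact Set.mem_biUnion (Finset.mem_coe.2 hR) hzR
  have h0 : volume (⋃ R ∈ 𝓡, (affineSpan ℝ (R : Set (Space d)) : Set (Space d))) = 0 :=
    (measure_biUnion_null_iff 𝓡.countable_toSet).2 fun R h' =>
      Measure.addHaar_affineSubspace _ _ (affineSpan_ne_top_of_card_le (hR R h'))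
  exact (hV.measure_pos volume hne).ne' (measure_mono_null hsub h0)

/-- Choose `z` off every span of `R`, then `y` off every span of `R ∪ {z}`, still proper because `R`
has at most `d - 1` points. A point `w` of the segment in the span of `R` would differ from `z`, and
the line through `z` and `w` would put `y` in the span of `R ∪ {z}`. -/
theorem exists_segment_avoiding (𝓡 : Finset (Finset (Space d)))
    (hR : ∀ R ∈ 𝓡, R.card + 1 ≤ d) {V V' : Set (Space d)} (hV : IsOpen V) (hne : V.Nonempty)
    (hV' : IsOpen V') (hne' : V'.Nonempty) :
    ∃ z ∈ V, ∃ y ∈ V', ∀ w ∈ segment ℝ z y, ∀ R ∈ 𝓡, w ∉ affineSpan ℝ (R : Set (Space d)) := by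
  obtain ⟨z, hz, hzR⟩ := exists_mem_notMem_affineSpan 𝓡 (fun R h => by have := hR R h; omega) hV hne
  obtain ⟨y, hy, hyR⟩ := exists_mem_notMem_affineSpan (𝓡.image (insert z)) (fun R h => by
    obtain ⟨R', hR', rfl⟩ := Finset.mem_image.1 h
    exact (Finset.card_insert_le _ _).trans (hR R' hR')) hV' hne'
  refine ⟨z, hz, y, hy, fun w hw R hRm hwR => ?_⟩
  rw [segment_eq_image_lineMap] at hw
  obtain ⟨t, -, rfl⟩ := hw
  have ht : t ≠ 0 := by
    rintro rfl
    rw [AffineMap.lineMap_apply_zero] at hwR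
    exact hzR R hRm hwR
  refine hyR (insert z R) (Finset.mem_image_of_mem _ hRm) ?_
  have hz' : z ∈ affineSpan ℝ ((insert z R : Finset (Space d)) : Set (Space d)) :=
    subset_affineSpan ℝ _ (by simp)
  have hw' : AffineMap.lineMap z y t ∈ affineSpan ℝ ((insert z R : Finset (Space d)) : Set (Space d)) :=
    affineSpan_mono ℝ (by simp) hwR
  have := AffineMap.lineMap_mem t⁻¹ hz' hw'
  have hy' : AffineMap.lineMap z (AffineMap.lineMap z y t) t⁻¹ = y := by
    simp only [AffineMap.lineMap_apply, vsub_eq_sub, vadd_eq_add, add_sub_cancel_right, smul_smul]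
    rw [inv_mul_cancel₀ ht, one_smul, sub_add_cancel]
  rwa [hy'] at this

/-! ### Pairs of simplices sharing a side -/

namespace Triangulation

variable {𝒯 : Triangulation d Ω} {T T' T₁ T₂ : 𝒯.cells} {P P' P₁ P₂ x : Space d}

theorem isSimplex (T : 𝒯.cells) : IsSimplex T.1 := ⟨𝒯.card_eq T T.2, 𝒯.indep T T.2⟩

/-- The simplices `T ≠ T'` share the side opposite to the vertex `P` of `T` and to the vertex `P'`
of `T'`. -/
structure Adj (T : 𝒯.cells) (P : Space d) (T' : 𝒯.cells) (P' : Space d) : Prop where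
  ne : T ≠ T'
  mem : P ∈ T.1
  mem' : P' ∈ T'.1
  erase_eq : T.1.erase P = T'.1.erase P'

namespace Adj

theorem symm (h : Adj T P T' P') : Adj T' P' T P := ⟨h.ne.symm, h.mem', h.mem, h.erase_eq.symm⟩

theorem notMem (h : Adj T P T' P') : P ∉ T'.1 := by
  intro hP
  refine h.ne (Subtype.ext (Finset.eq_of_subset_of_card_le ?_ ?_))
  · rw [← Finset.insert_erase h.mem, h.erase_eq]
    exact Finset.insert_subset hP (Finset.erase_subset _ _)
  · rw [(isSimplex T).card_eq, (isSimplex T').card_eq]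

theorem inter_eq (h : Adj T P T' P') :
    (T.1 : Set (Space d)) ∩ (T'.1 : Set (Space d)) = ((T.1.erase P : Finset (Space d)) : Set _) := by
  ext Q
  simp only [Set.mem_inter_iff, Finset.mem_coe]
  constructor
  · rintro ⟨h1, h2⟩
    exact Finset.mem_erase.2 ⟨fun e => h.notMem (e ▸ h2), h1⟩
  · intro hQ
    exact ⟨Finset.mem_of_mem_erase hQ, Finset.mem_of_mem_erase (h.erase_eq ▸ hQ)⟩

theorem hull_inter_subset (h : Adj T P T' P') : hull T.1 ∩ hull T'.1 ⊆ hull (T.1.erase P) := by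
  have := 𝒯.inter_subset T T.2 T' T'.2
  rwa [h.inter_eq] at this

theorem isInteriorSide (h : Adj T P T' P') : 𝒯.IsInteriorSide (T.1.erase P) T T' :=
  ⟨(isSimplex T).card_erase h.mem, h.ne, h.inter_eq.symm⟩

/-- Otherwise a point slightly off the centroid of the common side towards `P'` would lie in both
simplices, hence on the common side by conformity; but its coordinate for `P'` is positive. -/
theorem bary_neg (hd : d ≠ 0) (h : Adj T P T' P') : bary T.1 P P' < 0 := by
  by_contra! h0
  have hT := isSimplex T
  have hT' := isSimplex T'
  set S := T.1.erase P with hS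
  have hSne : S.Nonempty := hT.erase_nonempty hd h.mem
  have hcS := centroid_mem_hull hSne
  have hcont : Continuous fun t : ℝ => AffineMap.lineMap (centroid S) P' t :=
    AffineMap.lineMap_continuous
  -- At the centroid of the side these coordinates equal `1/d > 0`, so they stay positive for small
  -- `t`.
  have hev : ∀ᶠ t : ℝ in 𝓝[>] 0, ∀ Q ∈ S,
      0 < bary T.1 Q (AffineMap.lineMap (centroid S) P' t) := by
    refine (Filter.eventually_all_finset S).2 fun Q hQ => nhdsWithin_le_nhds ?_
    refine ((continuous_affineMap (bary T.1 Q)).comp hcont).continuousAt.eventually_const_lt ?_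
    simp only [Function.comp_apply, AffineMap.lineMap_apply_zero]
    rw [hT.bary_centroid_erase hd (Finset.mem_of_mem_erase hQ) h.mem,
      if_neg (Finset.ne_of_mem_erase hQ)]
    positivity
  obtain ⟨t, ht, ht0, ht1⟩ := (hev.and (Ioo_mem_nhdsGT (one_pos (α := ℝ)))).exists
  have hP0 : bary T.1 P (AffineMap.lineMap (centroid S) P' t) = t * bary T.1 P P' := by
    rw [AffineMap.apply_lineMap, hT.bary_centroid_erase hd h.mem h.mem, if_pos rfl]
    simp [AffineMap.lineMap_apply]
  have hx : AffineMap.lineMap (centroid S) P' t ∈ hull T.1 := by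
    rw [hT.mem_hull_iff]
    intro Q hQ
    by_cases hQP : Q = P
    · rw [hQP, hP0]; positivity
    · exact (ht Q (Finset.mem_erase.2 ⟨hQP, hQ⟩)).le
  have hx' : AffineMap.lineMap (centroid S) P' t ∈ hull T'.1 := by
    refine (convex_convexHull ℝ _).lineMap_mem ?_ (subset_convexHull ℝ _ h.mem') ⟨ht0.le, ht1.le⟩
    refine convexHull_mono ?_ hcS
    rw [hS, h.erase_eq]
    exact_mod_cast Finset.erase_subset _ _
  have hz := hT'.bary_eq_zero_of_mem_side h.mem' (h.erase_eq ▸ h.hull_inter_subset ⟨hx, hx'⟩)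
  rw [AffineMap.apply_lineMap, hT'.bary_self h.mem',
    hT'.bary_eq_zero_of_mem_side h.mem' (h.erase_eq ▸ hcS)] at hz
  simp [AffineMap.lineMap_apply] at hz
  exact ht0.ne' hz

/-- Both functions vanish on the common side, so they are proportional; evaluation at `P'` gives the
factor. -/
theorem bary_eq (h : Adj T P T' P') : bary T.1 P = bary T.1 P P' • bary T'.1 P' := by
  have hT := isSimplex T
  have hT' := isSimplex T'
  refine hT'.affineMap_ext fun Q hQ => ?_
  rw [AffineMap.coe_smul, Pi.smul_apply, smul_eq_mul]
  by_cases hQP : Q = P'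
  · rw [hQP, hT'.bary_self h.mem', mul_one]
  · have hQ' : Q ∈ T.1.erase P := by
      rw [h.erase_eq]; exact Finset.mem_erase.2 ⟨hQP, hQ⟩
    rw [hT'.bary_ne h.mem' hQ (Ne.symm hQP), mul_zero,
      hT.bary_ne h.mem (Finset.mem_of_mem_erase hQ') (Finset.ne_of_mem_erase hQ').symm]

/-- Three simplices cannot share a side, as their apexes would lie pairwise on opposite sides of one
hyperplane: `λ_P(P₂) = λ_P(P₁) λ_{P₁}(P₂)` would be negative and a product of two negative numbers.
-/
theorem unique (hd : d ≠ 0) (h₁ : Adj T P T₁ P₁) (h₂ : Adj T P T₂ P₂) : T₁ = T₂ ∧ P₁ = P₂ := by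
  have he : T₁.1.erase P₁ = T₂.1.erase P₂ := h₁.erase_eq.symm.trans h₂.erase_eq
  have hT : T₁ = T₂ := by
    by_contra hne
    have h : Adj T₁ P₁ T₂ P₂ := ⟨hne, h₁.mem', h₂.mem', he⟩
    have e := congrArg (fun g : Space d →ᵃ[ℝ] ℝ => g P₂) h₁.bary_eq
    simp only [AffineMap.coe_smul, Pi.smul_apply, smul_eq_mul] at e
    have := h₂.bary_neg hd
    rw [e] at this
    exact absurd this (not_lt.2 (mul_nonneg_of_nonpos_of_nonpos (h₁.bary_neg hd).le
      (h.bary_neg hd).le))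
  subst hT
  refine ⟨rfl, ?_⟩
  by_contra hne
  have : P₁ ∈ T₁.1.erase P₁ := by
    rw [he]; exact Finset.mem_erase.2 ⟨hne, h₁.mem'⟩
  simp at this

theorem baryGrad_eq (h : Adj T P T' P') :
    baryGrad T.1 P = bary T.1 P P' • baryGrad T'.1 P' := by
  refine ext_inner_right ℝ fun v => ?_
  rw [inner_smul_left, inner_baryGrad, inner_baryGrad]
  conv_lhs => rw [h.bary_eq]
  rfl

/-- The affine map that fixes the common side and sends `P` to `P'` maps `T` onto `T'`, and its
determinant is `λ_P(P') < 0`. -/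
theorem vol_eq (hd : d ≠ 0) (h : Adj T P T' P') : vol T'.1 = -bary T.1 P P' * vol T.1 := by
  have hT := isSimplex T
  set ψ := affineTransvection (bary T.1 P) (P' - P) with hψ
  have himg : ψ '' (T.1 : Set (Space d)) = (T'.1 : Set (Space d)) := by
    have h1 : ψ P = P' := by
      rw [hψ, affineTransvection_apply, hT.bary_self h.mem]; simp
    have h2 : ∀ Q ∈ T.1.erase P, ψ Q = Q := fun Q hQ => by
      rw [hψ, affineTransvection_apply, hT.bary_ne h.mem (Finset.mem_of_mem_erase hQ)
        (Finset.ne_of_mem_erase hQ).symm]; simp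
    rw [← Finset.coe_image, ← Finset.insert_erase h.mem, Finset.image_insert, h1,
      Finset.image_congr (g := id) h2, Finset.image_id, h.erase_eq, Finset.insert_erase h.mem']
  have hK : ψ '' hull T.1 = hull T'.1 := by
    rw [hull, ψ.image_convexHull, himg]
  have hdet : LinearMap.det ψ.linear = bary T.1 P P' := by
    rw [hψ, det_affineTransvection, ← vsub_eq_sub P', AffineMap.linearMap_vsub, hT.bary_self h.mem,
      vsub_eq_sub]
    ring
  rw [vol, vol, Measure.real, ← hK, addHaar_image_affineMap, hdet, ENNReal.toReal_mul,
    ENNReal.toReal_ofReal (abs_nonneg _), abs_of_neg (h.bary_neg hd), Measure.real]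

/-- Up to a common factor, `|T| ∇λ_P` is the area of a side times its inner normal. -/
theorem vol_smul_baryGrad (hd : d ≠ 0) (h : Adj T P T' P') :
    vol T'.1 • baryGrad T'.1 P' = -(vol T.1 • baryGrad T.1 P) := by
  rw [h.vol_eq hd, h.baryGrad_eq, smul_smul, ← neg_smul]
  congr 1
  ring

/-- Near `x` the coordinates belonging to the side stay positive in both simplices. Since `λ_P` and
`λ_{P'}` have opposite signs, the sign of `λ_P` decides which simplex contains a point. -/
theorem mem_interior (hd : d ≠ 0) (h : Adj T P T' P') (hx : x ∈ hull (T.1.erase P))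
    (hpos : ∀ Q ∈ T.1.erase P, 0 < bary T.1 Q x) : x ∈ interior (hull T.1 ∪ hull T'.1) := by
  have hT := isSimplex T
  have hT' := isSimplex T'
  -- On the common side the coordinates of its vertices agree for the two simplices.
  have hpos' : ∀ Q ∈ T.1.erase P, 0 < bary T'.1 Q x := fun Q hQ => by
    have hQ' : Q ∈ T'.1.erase P' := h.erase_eq ▸ hQ
    have : bary T'.1 Q x = bary T.1 Q x := by
      rw [hT.affineMap_apply (bary T'.1 Q) x, ← Finset.add_sum_erase _ _ h.mem,
        hT.bary_eq_zero_of_mem_side h.mem hx, zero_smul, zero_add]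
      have e : ∀ R ∈ T.1.erase P, bary T.1 R x • bary T'.1 Q R = if Q = R then bary T.1 R x else 0 :=
        fun R hR => by
          rw [hT'.bary_apply (Finset.mem_of_mem_erase hQ')
            (Finset.mem_of_mem_erase (h.erase_eq ▸ hR))]
          simp
      rw [Finset.sum_congr rfl e, Finset.sum_ite_eq, if_pos hQ]
    rw [this]; exact hpos Q hQ
  rw [mem_interior_iff_mem_nhds]
  have hev : ∀ᶠ y in 𝓝 x, ∀ Q ∈ T.1.erase P, 0 < bary T.1 Q y ∧ 0 < bary T'.1 Q y :=
    (Filter.eventually_all_finset _).2 fun Q hQ =>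
      ((continuous_affineMap (bary T.1 Q)).continuousAt.eventually_const_lt (hpos Q hQ)).and
        ((continuous_affineMap (bary T'.1 Q)).continuousAt.eventually_const_lt (hpos' Q hQ))
  filter_upwards [hev] with y hy
  rcases le_or_gt 0 (bary T.1 P y) with h0 | h0
  · left
    rw [hT.mem_hull_iff]
    intro Q hQ
    by_cases hQP : Q = P
    · rwa [hQP]
    · exact (hy Q (Finset.mem_erase.2 ⟨hQP, hQ⟩)).1.le
  · right
    rw [hT'.mem_hull_iff]
    intro Q hQ
    by_cases hQP : Q = P'
    · rw [h.bary_eq, AffineMap.coe_smul, Pi.smul_apply, smul_eq_mul] at h0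
      rw [hQP]
      by_contra! hneg
      exact absurd h0 (not_lt.2 (mul_nonneg_of_nonpos_of_nonpos (h.bary_neg hd).le hneg.le))
    · exact (hy Q (by rw [h.erase_eq]; exact Finset.mem_erase.2 ⟨hQP, hQ⟩)).2.le

end Adj

theorem exists_eq_erase {S : Finset (Space d)} (hS : S ⊆ T.1) (hc : S.card = d) :
    ∃ P ∈ T.1, S = T.1.erase P := by
  obtain ⟨P, hP, hPe⟩ := Finset.covBy_iff_exists_cons.1
    (Finset.covBy_iff_card_sdiff_eq_one.2 ⟨hS, by
      rw [Finset.card_sdiff_of_subset hS, (isSimplex T).card_eq, hc]; omega⟩)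
  refine ⟨P, ?_, ?_⟩
  · rw [← hPe]; simp
  · rw [← hPe]; simp [Finset.cons_eq_insert, hP]

theorem IsInteriorSide.exists_adj {S : Finset (Space d)} (h : 𝒯.IsInteriorSide S T T') :
    ∃ P P', Adj T P T' P' ∧ S = T.1.erase P := by
  obtain ⟨hc, hne, hS⟩ := h
  have hS' : S = T.1 ∩ T'.1 := by
    apply Finset.coe_injective; rw [hS, Finset.coe_inter]
  obtain ⟨P, hP, e⟩ := exists_eq_erase (hS' ▸ Finset.inter_subset_left : S ⊆ T.1) hc
  obtain ⟨P', hP', e'⟩ := exists_eq_erase (hS' ▸ Finset.inter_subset_right : S ⊆ T'.1) hc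
  exact ⟨P, P', ⟨hne, hP, hP', e.symm.trans e'⟩, e⟩

end Triangulation
end StokesCR
end

/-! ### Topology of the mesh: interior sides, boundary sides, connectedness -/

noncomputable section

namespace StokesCR

open scoped Classical

variable {d : ℕ} {Ω ΓD ΓN : Set (Space d)}

namespace Triangulation

variable {𝒯 : Triangulation d Ω} {T T' : 𝒯.cells} {P P' x : Space d}

theorem hull_subset_closure (T : 𝒯.cells) : hull T.1 ⊆ closure Ω := by
  rw [← 𝒯.cover]
  exact Set.subset_biUnion_of_mem (u := fun T : Finset (Space d) => hull T) T.2

theorem exists_mem_hull (𝒯 : Triangulation d Ω) (hx : x ∈ closure Ω) :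
    ∃ T : 𝒯.cells, x ∈ hull T.1 := by
  rw [← 𝒯.cover] at hx
  simp only [Set.mem_iUnion] at hx
  obtain ⟨T, hT, hx⟩ := hx
  exact ⟨⟨T, hT⟩, hx⟩

theorem isClosed_biUnion_hull (q : 𝒯.cells → Prop) :
    IsClosed (⋃ T ∈ {T : 𝒯.cells | q T}, hull T.1) :=
  (Set.toFinite _).isClosed_biUnion fun T _ => (IsSimplex.isCompact_hull T.1).isClosed

theorem mem_biUnion_hull {q : 𝒯.cells → Prop} :
    x ∈ (⋃ T ∈ {T : 𝒯.cells | q T}, hull T.1) ↔ ∃ T, q T ∧ x ∈ hull T.1 := by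
  simp only [Set.mem_iUnion, Set.mem_ofPred_eq, exists_prop]

/-- A side whose relative interior meets another simplex is an interior side. -/
theorem exists_adj_of_mem_hull (hP : P ∈ T.1) (hne : T ≠ T') (hx : x ∈ hull T.1)
    (hx' : x ∈ hull T'.1) (hpos : ∀ Q ∈ T.1.erase P, 0 < bary T.1 Q x) :
    ∃ P', Adj T P T' P' := by
  have hT := isSimplex T
  have hmem := 𝒯.inter_subset T T.2 T' T'.2 ⟨hx, hx'⟩
  rw [← Finset.coe_inter] at hmem
  have h0 := ((hT.mem_convexHull_iff_of_subset Finset.inter_subset_left).1 hmem).2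
  have hsub : T.1.erase P ⊆ T'.1 := fun Q hQ => by
    by_contra hQ'
    exact (hpos Q hQ).ne' (h0 Q (Finset.mem_of_mem_erase hQ) fun h => hQ' (Finset.mem_inter.1 h).2)
  obtain ⟨P', hP', e⟩ := exists_eq_erase hsub (hT.card_erase hP)
  exact ⟨P', hne, hP, hP', e⟩

/-- Every side is an interior side or lies in the boundary. -/
theorem exists_adj_or_subset_frontier (hd : d ≠ 0) (hΩ : IsLipschitzDomain Ω) (hP : P ∈ T.1) :
    (∃ T' P', Adj T P T' P') ∨ hull (T.1.erase P) ⊆ frontier Ω := by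
  by_contra! h
  obtain ⟨hadj, hfr⟩ := h
  obtain ⟨x, hxS, hxf⟩ := Set.not_subset.1 hfr
  have hT := isSimplex T
  have hSsub : hull (T.1.erase P) ⊆ hull T.1 :=
    convexHull_mono (by exact_mod_cast Finset.erase_subset _ _)
  have hxΩ : x ∈ Ω := by
    by_contra hx
    rw [hΩ.isOpen.frontier_eq] at hxf
    exact hxf ⟨hull_subset_closure T (hSsub hxS), hx⟩
  set c := centroid (T.1.erase P) with hc
  have hcS : c ∈ hull (T.1.erase P) := centroid_mem_hull (hT.erase_nonempty hd hP)
  have hΩn := hΩ.isOpen.mem_nhds hxΩ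
  -- A small move from `x` towards the centroid stays in `Ω` and reaches the relative interior of
  -- the side.
  have hcont : Continuous fun t : ℝ => AffineMap.lineMap x c t := AffineMap.lineMap_continuous
  have hev : ∀ᶠ t : ℝ in 𝓝[>] 0, AffineMap.lineMap x c t ∈ Ω :=
    nhdsWithin_le_nhds (hcont.continuousAt (by simpa using hΩn))
  obtain ⟨t, htΩ, ht0, ht1⟩ := (hev.and (Ioo_mem_nhdsGT (one_pos (α := ℝ)))).exists
  set y := AffineMap.lineMap x c t with hy
  have hyS : y ∈ hull (T.1.erase P) :=
    (convex_convexHull ℝ _).lineMap_mem hxS hcS ⟨ht0.le, ht1.le⟩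
  have hpos : ∀ Q ∈ T.1.erase P, 0 < bary T.1 Q y := fun Q hQ => by
    have h1 := hT.bary_nonneg (hSsub hxS) (Finset.mem_of_mem_erase hQ)
    rw [hy, AffineMap.apply_lineMap, hc, hT.bary_centroid_erase hd (Finset.mem_of_mem_erase hQ) hP,
      if_neg (Finset.ne_of_mem_erase hQ)]
    have h2 : (0 : ℝ) < (d : ℝ)⁻¹ := by positivity
    simp only [AffineMap.lineMap_apply, vsub_eq_sub, vadd_eq_add, smul_eq_mul]
    nlinarith [mul_nonneg (sub_nonneg.2 ht1.le) h1, mul_pos ht0 h2]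
  have hP0 := hT.bary_eq_zero_of_mem_side hP hyS
  have hnot : y ∉ ⋃ T' ∈ {T' : 𝒯.cells | T ≠ T'}, hull T'.1 := fun h => by
    obtain ⟨T', hne, hyT'⟩ := mem_biUnion_hull.1 h
    obtain ⟨P', h'⟩ := exists_adj_of_mem_hull hP hne (hSsub hyS) hyT' hpos
    exact hadj T' P' h'
  have hnhds : Ω ∩ (⋃ T' ∈ {T' : 𝒯.cells | T ≠ T'}, hull T'.1)ᶜ ∈ 𝓝 y :=
    Filter.inter_mem (hΩ.isOpen.mem_nhds htΩ) ((isClosed_biUnion_hull _).isOpen_compl.mem_nhds hnot)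
  -- Crossing the side at `y` away from `P` makes `λ_P` negative, so one leaves `T` while staying in
  -- `Ω` and off all other simplices. This contradicts the covering.
  have hcont' : Continuous fun s : ℝ => AffineMap.lineMap y P s := AffineMap.lineMap_continuous
  have hev' : ∀ᶠ s : ℝ in 𝓝[<] 0, AffineMap.lineMap y P s ∈
      Ω ∩ (⋃ T' ∈ {T' : 𝒯.cells | T ≠ T'}, hull T'.1)ᶜ :=
    nhdsWithin_le_nhds (hcont'.continuousAt (by simpa using hnhds))
  obtain ⟨s, ⟨hsΩ, hs⟩, hs0⟩ := (hev'.and self_mem_nhdsWithin).exists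
  have hs0' : s < 0 := hs0
  obtain ⟨T', hsT'⟩ := exists_mem_hull 𝒯 (subset_closure hsΩ)
  by_cases hTT' : T = T'
  · subst hTT'
    have h1 := hT.bary_nonneg hsT' hP
    rw [AffineMap.apply_lineMap, hP0, hT.bary_self hP] at h1
    simp [AffineMap.lineMap_apply] at h1
    linarith
  · exact hs (mem_biUnion_hull.2 ⟨T', hTT', hsT'⟩)

/-- The centroid of a common side is interior to the union of the two simplices, hence to `closure
Ω`. -/
theorem Adj.not_hull_subset_frontier (hd : d ≠ 0) (hΩ : IsLipschitzDomain Ω)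
    (h : Adj T P T' P') : ¬ hull (T.1.erase P) ⊆ frontier Ω := fun hsub => by
  have hT := isSimplex T
  have hc := centroid_mem_hull (hT.erase_nonempty hd h.mem)
  refine hΩ.notMem_frontier (interior_mono (Set.union_subset (hull_subset_closure T)
    (hull_subset_closure T')) (h.mem_interior hd hc fun Q hQ => ?_)) (hsub hc)
  rw [hT.bary_centroid_erase hd (Finset.mem_of_mem_erase hQ) h.mem,
    if_neg (Finset.ne_of_mem_erase hQ)]
  positivity

theorem IsBoundarySide.not_adj (hd : d ≠ 0) (hΩ : IsLipschitzDomain Ω)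
    (hS : 𝒯.IsBoundarySide (T.1.erase P) T) : ¬ Adj T P T' P' :=
  fun h => h.not_hull_subset_frontier hd hΩ hS.2.2

theorem isBoundarySide_of_not_adj (hd : d ≠ 0) (hΩ : IsLipschitzDomain Ω) (hP : P ∈ T.1)
    (h : ∀ T' P', ¬ Adj T P T' P') : 𝒯.IsBoundarySide (T.1.erase P) T :=
  ⟨(isSimplex T).card_erase hP, Finset.erase_subset _ _,
    (exists_adj_or_subset_frontier hd hΩ hP).resolve_left fun ⟨T', P', h'⟩ => h T' P' h'⟩

theorem interior_hull_inter_nonempty (hx : x ∈ hull T.1) {V : Set (Space d)} (hV : V ∈ 𝓝 x) :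
    (V ∩ interior (hull T.1)).Nonempty := by
  have hne : (interior (hull T.1)).Nonempty :=
    ⟨centroid T.1, (isSimplex T).mem_interior_hull_iff.2 fun P hP => by
      rw [(isSimplex T).bary_centroid hP]; positivity⟩
  have hcl := (convex_convexHull ℝ (T.1 : Set (Space d))).closure_interior_eq_closure_of_nonempty_interior hne
  have hx' : x ∈ closure (interior (hull T.1)) := by
    rw [hcl]; exact subset_closure hx
  exact mem_closure_iff_nhds.1 hx' V hV

/-- The faces of the triangulation of codimension at least two. -/
def skeleton (𝒯 : Triangulation d Ω) : Finset (Finset (Space d)) :=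
  (𝒯.cells.biUnion Finset.powerset).filter fun R => R.card + 1 ≤ d

theorem mem_skeleton {R : Finset (Space d)} (hR : R ⊆ T.1) (hc : R.card + 1 ≤ d) :
    R ∈ 𝒯.skeleton :=
  Finset.mem_filter.2 ⟨Finset.mem_biUnion.2 ⟨T.1, T.2, Finset.mem_powerset.2 hR⟩, hc⟩

theorem notMem_hull_of_skeleton {R : Finset (Space d)} (hR : R ⊆ T.1)
    (hx : ∀ R ∈ 𝒯.skeleton, x ∉ affineSpan ℝ (R : Set (Space d))) (hxR : x ∈ hull R) :
    d ≤ R.card := by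
  by_contra! hc
  exact hx R (mem_skeleton hR hc) (convexHull_subset_affineSpan _ hxR)

/-- The simplices of a triangulation are connected through interior sides. -/
theorem forall_of_adj (hΩ : IsLipschitzDomain Ω) (q : 𝒯.cells → Prop)
    (hq : ∀ T P T' P', Adj T P T' P' → q T → q T') {T₀ : 𝒯.cells} (h₀ : q T₀) (T : 𝒯.cells) :
    q T := by
  by_contra hT
  set A := ⋃ T ∈ {T : 𝒯.cells | q T}, hull T.1 with hA
  set B := ⋃ T ∈ {T : 𝒯.cells | ¬ q T}, hull T.1 with hB
  have hcov : Ω ⊆ A ∪ B := fun x hx => by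
    obtain ⟨U, hU⟩ := exists_mem_hull 𝒯 (subset_closure hx)
    by_cases h : q U
    · exact Or.inl (mem_biUnion_hull.2 ⟨U, h, hU⟩)
    · exact Or.inr (mem_biUnion_hull.2 ⟨U, h, hU⟩)
  have hmeet : ∀ U : 𝒯.cells, (Ω ∩ hull U.1).Nonempty := fun U => by
    have hc := centroid_mem_hull (isSimplex U).nonempty
    obtain ⟨y, -, hy⟩ := interior_hull_inter_nonempty hc Filter.univ_mem
    obtain ⟨z, hz, hzΩ⟩ := mem_closure_iff.1 (hull_subset_closure U (interior_subset hy)) _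
      isOpen_interior hy
    exact ⟨z, hzΩ, interior_subset hz⟩
  -- The closed sets `A` and `B` cover the connected set `Ω` and both meet it, so they meet inside
  -- `Ω`.
  obtain ⟨x, hxΩ, hxA, hxB⟩ := isPreconnected_closed_iff.1 hΩ.isConnected.isPreconnected A B
    (isClosed_biUnion_hull _) (isClosed_biUnion_hull _) hcov
    (by obtain ⟨z, hz, hz'⟩ := hmeet T₀; exact ⟨z, hz, mem_biUnion_hull.2 ⟨T₀, h₀, hz'⟩⟩)
    (by obtain ⟨z, hz, hz'⟩ := hmeet T; exact ⟨z, hz, mem_biUnion_hull.2 ⟨T, hT, hz'⟩⟩)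
  obtain ⟨U, hqU, hxU⟩ := mem_biUnion_hull.1 hxA
  obtain ⟨U', hqU', hxU'⟩ := mem_biUnion_hull.1 hxB
  obtain ⟨ε, hε, hball⟩ := Metric.isOpen_iff.1 hΩ.isOpen x hxΩ
  have hbn := Metric.ball_mem_nhds x hε
  -- The meeting point `x` may lie on a low-dimensional face. It is replaced by a point `w` of `A ∩
  -- B` on a nearby segment that misses all faces of codimension at least two.
  obtain ⟨z, ⟨hzV, hzU⟩, y, ⟨hyV, hyU'⟩, hseg⟩ := exists_segment_avoiding 𝒯.skeleton
    (fun R hR => (Finset.mem_filter.1 hR).2)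
    (Metric.isOpen_ball.inter isOpen_interior) (interior_hull_inter_nonempty hxU hbn)
    (Metric.isOpen_ball.inter isOpen_interior) (interior_hull_inter_nonempty hxU' hbn)
  have hsegΩ : segment ℝ z y ⊆ A ∪ B :=
    (((convex_ball x ε).segment_subset hzV hyV).trans hball).trans hcov
  obtain ⟨w, hw, hwA, hwB⟩ := isPreconnected_closed_iff.1 (convex_segment z y).isPreconnected A B
    (isClosed_biUnion_hull _) (isClosed_biUnion_hull _) hsegΩ
    ⟨z, left_mem_segment ℝ z y, mem_biUnion_hull.2 ⟨U, hqU, interior_subset hzU⟩⟩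
    ⟨y, right_mem_segment ℝ z y, mem_biUnion_hull.2 ⟨U', hqU', interior_subset hyU'⟩⟩
  obtain ⟨T₁, h₁, hw₁⟩ := mem_biUnion_hull.1 hwA
  obtain ⟨T₂, h₂, hw₂⟩ := mem_biUnion_hull.1 hwB
  have hne : T₁ ≠ T₂ := fun h => h₂ (h ▸ h₁)
  have hmem := 𝒯.inter_subset T₁ T₁.2 T₂ T₂.2 ⟨hw₁, hw₂⟩
  rw [← Finset.coe_inter] at hmem
  -- The common face containing `w` has at least `d` vertices, and at most `d` because the simplices
  -- differ; so it is a common side, across which `q` propagates.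
  have hge := notMem_hull_of_skeleton (T := T₁) Finset.inter_subset_left (hseg w hw) hmem
  have hle : (T₁.1 ∩ T₂.1).card ≤ d := by
    by_contra! hlt
    have e₁ := Finset.eq_of_subset_of_card_le (Finset.inter_subset_left (s₁ := T₁.1) (s₂ := T₂.1))
      (by rw [(isSimplex T₁).card_eq]; omega)
    have e₂ := Finset.eq_of_subset_of_card_le (Finset.inter_subset_right (s₁ := T₁.1) (s₂ := T₂.1))
      (by rw [(isSimplex T₂).card_eq]; omega)
    exact hne (Subtype.ext (e₁.symm.trans e₂))
  obtain ⟨P, P', hadj, -⟩ := IsInteriorSide.exists_adj (S := T₁.1 ∩ T₂.1) (T := T₁) (T' := T₂)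
    ⟨le_antisymm hle hge, hne, Finset.coe_inter _ _⟩
  exact h₂ (hq _ _ _ _ hadj h₁)

/-- The boundary is covered by the boundary sides. -/
theorem exists_isBoundarySide_mem (hd : d ≠ 0) (hΩ : IsLipschitzDomain Ω) (𝒯 : Triangulation d Ω)
    (hx : x ∈ frontier Ω) :
    ∃ (T : 𝒯.cells) (P : Space d), P ∈ T.1 ∧ 𝒯.IsBoundarySide (T.1.erase P) T ∧
      x ∈ hull (T.1.erase P) := by
  by_contra! hno
  set I : Set (𝒯.cells × Space d) :=
    {a | a.2 ∈ a.1.1 ∧ 𝒯.IsBoundarySide (a.1.1.erase a.2) a.1} with hI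
  have hIfin : I.Finite := by
    refine ((Set.finite_univ (α := 𝒯.cells)).prod
      (𝒯.cells.biUnion id).finite_toSet).subset fun a ha => ⟨Set.mem_univ _, ?_⟩
    exact Finset.mem_coe.2 (Finset.mem_biUnion.2 ⟨a.1.1, a.1.2, ha.1⟩)
  have hcl : IsClosed (⋃ a ∈ I, hull (a.1.1.erase a.2)) :=
    hIfin.isClosed_biUnion fun a _ => (IsSimplex.isCompact_hull _).isClosed
  have hxn : x ∉ ⋃ a ∈ I, hull (a.1.1.erase a.2) := fun h => by
    simp only [Set.mem_iUnion] at h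
    obtain ⟨a, ha, hxa⟩ := h
    exact hno a.1 a.2 ha.1 ha.2 hxa
  obtain ⟨ε, hε, hball⟩ := Metric.isOpen_iff.1 hcl.isOpen_compl x hxn
  have hbn := Metric.ball_mem_nhds x hε
  obtain ⟨U, hxU⟩ := exists_mem_hull 𝒯 (frontier_subset_closure hx)
  obtain ⟨z, ⟨hzV, hzU⟩, y, ⟨hyV, hy⟩, hseg⟩ := exists_segment_avoiding 𝒯.skeleton
    (fun R hR => (Finset.mem_filter.1 hR).2)
    (Metric.isOpen_ball.inter isOpen_interior) (interior_hull_inter_nonempty hxU hbn)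
    (Metric.isOpen_ball.inter isClosed_closure.isOpen_compl)
    (hΩ.inter_compl_closure_nonempty hx hbn)
  -- The segment runs from the interior of `closure Ω` to its complement, so it passes through the
  -- boundary of `closure Ω`.
  obtain ⟨w, hw, hwc, hwi⟩ : ∃ w ∈ segment ℝ z y, w ∈ closure Ω ∧ w ∉ interior (closure Ω) := by
    by_contra! h
    obtain ⟨w, -, hwi, hwc⟩ := (convex_segment (𝕜 := ℝ) z y).isPreconnected _ _ isOpen_interior
      (isClosed_closure (s := Ω)).isOpen_compl
      (fun w hw => (em (w ∈ closure Ω)).imp (fun hc => h w hw hc) id)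
      ⟨z, left_mem_segment ℝ z y, interior_mono (hull_subset_closure U) hzU⟩
      ⟨y, right_mem_segment ℝ z y, hy⟩
    exact hwc (interior_subset hwi)
  obtain ⟨T, hwT⟩ := exists_mem_hull 𝒯 hwc
  have hT := isSimplex T
  -- The smallest face of `T` containing `w` has at least `d` vertices, since `w` avoids the
  -- skeleton. It is not all of `T`, since `w` is not interior to `closure Ω`. Hence `w` is in the
  -- relative interior of a side.
  have hsupp : w ∈ hull (T.1.filter fun Q => bary T.1 Q w ≠ 0) :=
    (hT.mem_convexHull_iff_of_subset (Finset.filter_subset _ _)).2 ⟨hwT, fun Q hQ hQ' => by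
      by_contra h
      exact hQ' (Finset.mem_filter.2 ⟨hQ, h⟩)⟩
  have hge := notMem_hull_of_skeleton (T := T) (Finset.filter_subset _ _) (hseg w hw) hsupp
  obtain ⟨P, hP, hP0⟩ : ∃ P ∈ T.1, bary T.1 P w = 0 := by
    by_contra! h
    exact hwi (interior_mono (hull_subset_closure T) (hT.mem_interior_hull_iff.2 fun Q hQ =>
      lt_of_le_of_ne (hT.bary_nonneg hwT hQ) (h Q hQ).symm))
  have hsub : (T.1.filter fun Q => bary T.1 Q w ≠ 0) ⊆ T.1.erase P := fun Q hQ => by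
    obtain ⟨h1, h2⟩ := Finset.mem_filter.1 hQ
    exact Finset.mem_erase.2 ⟨fun e => h2 (e ▸ hP0), h1⟩
  have heq := Finset.eq_of_subset_of_card_le hsub (by rw [hT.card_erase hP]; exact hge)
  rw [heq] at hsupp
  have hpos : ∀ Q ∈ T.1.erase P, 0 < bary T.1 Q w := fun Q hQ =>
    lt_of_le_of_ne (hT.bary_nonneg hwT (Finset.mem_of_mem_erase hQ))
      (Finset.mem_filter.1 (heq ▸ hQ)).2.symm
  -- A neighbour across this side would make `w` interior to `closure Ω`.
  have hbs : 𝒯.IsBoundarySide (T.1.erase P) T := isBoundarySide_of_not_adj hd hΩ hP fun T' P' h =>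
    hwi (interior_mono (Set.union_subset (hull_subset_closure T) (hull_subset_closure T'))
      (h.mem_interior hd hsupp hpos))
  exact hball ((convex_ball x ε).segment_subset hzV hyV hw)
    (Set.mem_biUnion (x := (T, P)) ⟨hP, hbs⟩ hsupp)

theorem affineIndependent_erase (T : 𝒯.cells) (P : Space d) :
    AffineIndependent ℝ ((↑) : (T.1.erase P : Finset (Space d)) → Space d) :=
  (isSimplex T).indep.mono (by exact_mod_cast Finset.erase_subset _ _)

theorem IsBoundarySideIn.not_of_disjoint {Γ Γ' : Set (Space d)} (hΓ : Disjoint Γ Γ')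
    {S : Finset (Space d)} (h : 𝒯.IsBoundarySideIn Γ S T) (hne : S.Nonempty) :
    ¬ 𝒯.IsBoundarySideIn Γ' S T' := fun h' => by
  obtain ⟨y, hy⟩ := Set.Nonempty.intrinsicInterior (convex_convexHull ℝ (S : Set (Space d)))
    (by rw [convexHull_nonempty_iff]; exact_mod_cast hne)
  exact hΓ.le_bot ⟨h.2 hy, h'.2 hy⟩

/-- A nonempty part of the boundary that is resolved by the triangulation contains a side. -/
theorem exists_isBoundarySideIn (hd : d ≠ 0) (hΩ : IsLipschitzDomain Ω) (𝒯 : Triangulation d Ω)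
    {Γ Γ' : Set (Space d)} (hΓ : Disjoint Γ Γ') (hopen : ∃ U, IsOpen U ∧ Γ = U ∩ frontier Ω)
    (hne : Γ.Nonempty)
    (hres : ∀ S T, 𝒯.IsBoundarySide S T → 𝒯.IsBoundarySideIn Γ S T ∨ 𝒯.IsBoundarySideIn Γ' S T) :
    ∃ (T : 𝒯.cells) (P : Space d), P ∈ T.1 ∧ 𝒯.IsBoundarySideIn Γ (T.1.erase P) T := by
  obtain ⟨U, hU, hΓU⟩ := hopen
  obtain ⟨x, hx⟩ := hne
  have hx' := hx
  rw [hΓU] at hx'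
  obtain ⟨T, P, hP, hS, hxS⟩ := exists_isBoundarySide_mem hd hΩ 𝒯 hx'.2
  refine ⟨T, P, hP, (hres _ _ hS).resolve_right fun h' => ?_⟩
  -- `Γ` is relatively open and the relative interior is dense in the side, so it contains a point
  -- of `Γ` and cannot lie in the disjoint `Γ'`.
  obtain ⟨y, hyU, hy⟩ := exists_mem_intrinsicInterior ((isSimplex T).erase_nonempty hd hP)
    (affineIndependent_erase T P) hxS hU hx'.1
  exact hΓ.le_bot ⟨by rw [hΓU]; exact ⟨hyU, hS.2.2 (intrinsicInterior_subset hy)⟩, h'.2 hy⟩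

end Triangulation
end StokesCR
end

noncomputable section

namespace StokesCR

open scoped Classical

variable {d : ℕ}

/-! ### Tensor algebra -/

theorem inner_eq_sum (a b : Space d) : inner ℝ a b = ∑ i, a i * b i := by
  rw [PiLp.inner_apply]
  exact Finset.sum_congr rfl fun i _ => by simp [mul_comm]

theorem act_apply (A : Tensor d) (x : Space d) (i : Fin d) : act A x i = ∑ j, A i j * x j := rfl

theorem act_add (A B : Tensor d) (x : Space d) : act (A + B) x = act A x + act B x := by
  ext i; simp [act, Matrix.add_mulVec]

theorem act_sub (A B : Tensor d) (x : Space d) : act (A - B) x = act A x - act B x := by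
  ext i; simp [act, Matrix.sub_mulVec]

theorem act_smul (c : ℝ) (A : Tensor d) (x : Space d) : act (c • A) x = c • act A x := by
  ext i; simp [act, Matrix.smul_mulVec]

theorem act_add_right (A : Tensor d) (x y : Space d) : act A (x + y) = act A x + act A y := by
  ext i; simp [act, Matrix.mulVec_add]

theorem act_smul_right (c : ℝ) (A : Tensor d) (x : Space d) : act A (c • x) = c • act A x := by
  ext i; simp [act, Matrix.mulVec_smul]

theorem act_neg_right (A : Tensor d) (x : Space d) : act A (-x) = -act A x := by
  ext i; simp [act, Matrix.mulVec_neg]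

theorem act_one (x : Space d) : act 1 x = x := by
  ext i; simp [act]

theorem act_zero (x : Space d) : act 0 x = 0 := by
  ext i; simp [act]

theorem act_dyad (a b x : Space d) : act (dyad a b) x = inner ℝ b x • a := by
  ext i
  rw [act_apply, inner_eq_sum, PiLp.smul_apply, smul_eq_mul, Finset.sum_mul]
  exact Finset.sum_congr rfl fun j _ => by simp [dyad]; ring

theorem dyad_add_right (a b c : Space d) : dyad a (b + c) = dyad a b + dyad a c := by
  ext i j; simp [dyad, mul_add]

theorem dyad_smul_right (r : ℝ) (a b : Space d) : dyad a (r • b) = r • dyad a b := by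
  ext i j; simp [dyad]; ring

theorem dyad_smul_left (r : ℝ) (a b : Space d) : dyad (r • a) b = r • dyad a b := by
  ext i j; simp [dyad]; ring

theorem dyad_neg_left (a b : Space d) : dyad (-a) b = -dyad a b := by
  ext i j; simp [dyad]

theorem frob_comm (A B : Tensor d) : frob A B = frob B A := by
  simp only [frob, mul_comm]

theorem frob_add_left (A B C : Tensor d) : frob (A + B) C = frob A C + frob B C := by
  simp only [frob, Matrix.add_apply, add_mul, Finset.sum_add_distrib]

theorem frob_sub_left (A B C : Tensor d) : frob (A - B) C = frob A C - frob B C := by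
  simp only [frob, Matrix.sub_apply, sub_mul, Finset.sum_sub_distrib]

theorem frob_smul_left (c : ℝ) (A B : Tensor d) : frob (c • A) B = c * frob A B := by
  simp only [frob, Matrix.smul_apply, smul_eq_mul, mul_assoc, Finset.mul_sum]

theorem frob_add_right (A B C : Tensor d) : frob A (B + C) = frob A B + frob A C := by
  rw [frob_comm, frob_add_left, frob_comm B, frob_comm C]

theorem frob_sub_right (A B C : Tensor d) : frob A (B - C) = frob A B - frob A C := by
  rw [frob_comm, frob_sub_left, frob_comm B, frob_comm C]

theorem frob_smul_right (c : ℝ) (A B : Tensor d) : frob A (c • B) = c * frob A B := by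
  rw [frob_comm, frob_smul_left, frob_comm]

theorem frob_sum_right {α : Type*} (s : Finset α) (A : Tensor d) (B : α → Tensor d) :
    frob A (∑ a ∈ s, B a) = ∑ a ∈ s, frob A (B a) := by
  induction s using Finset.induction_on with
  | empty => simp [frob]
  | insert a s ha ih => rw [Finset.sum_insert ha, Finset.sum_insert ha, frob_add_right, ih]

theorem frob_dyad (A : Tensor d) (a b : Space d) : frob A (dyad a b) = inner ℝ a (act A b) := by
  rw [inner_eq_sum]
  refine Finset.sum_congr rfl fun i _ => ?_
  rw [act_apply, Finset.mul_sum]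
  exact Finset.sum_congr rfl fun j _ => by simp [dyad]; ring

theorem frob_one (A : Tensor d) : frob A 1 = A.trace := by
  refine Finset.sum_congr rfl fun i _ => ?_
  simp [Matrix.one_apply]

theorem frob_self_nonneg (A : Tensor d) : 0 ≤ frob A A :=
  Finset.sum_nonneg fun _ _ => Finset.sum_nonneg fun _ _ => mul_self_nonneg _

theorem frob_self_eq_zero {A : Tensor d} (h : frob A A = 0) : A = 0 := by
  ext i j
  have h1 := (Finset.sum_eq_zero_iff_of_nonneg fun i _ =>
    Finset.sum_nonneg fun j _ => mul_self_nonneg (A i j)).1 h i (Finset.mem_univ i)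
  have h2 := (Finset.sum_eq_zero_iff_of_nonneg fun j _ => mul_self_nonneg (A i j)).1 h1 j
    (Finset.mem_univ j)
  simpa using h2

theorem trace_dev (hd : d ≠ 0) (A : Tensor d) : (dev A).trace = 0 := by
  have : (d : ℝ) ≠ 0 := by exact_mod_cast hd
  rw [dev, Matrix.trace_sub, Matrix.trace_smul, Matrix.trace_one, Fintype.card_fin, smul_eq_mul,
    div_mul_cancel₀ _ this, sub_self]

theorem dev_of_trace_eq_zero {A : Tensor d} (h : A.trace = 0) : dev A = A := by
  simp [dev, h]

theorem dev_add (A B : Tensor d) : dev (A + B) = dev A + dev B := by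
  simp only [dev, Matrix.trace_add, add_div, add_smul]; abel

theorem dev_sub (A B : Tensor d) : dev (A - B) = dev A - dev B := by
  simp only [dev, Matrix.trace_sub, sub_div, sub_smul]; abel

theorem dev_smul_one (hd : d ≠ 0) (c : ℝ) : dev (c • (1 : Tensor d)) = 0 := by
  have : (d : ℝ) ≠ 0 := by exact_mod_cast hd
  rw [dev, Matrix.trace_smul, Matrix.trace_one, Fintype.card_fin, smul_eq_mul,
    mul_div_cancel_right₀ _ this, sub_self]

/-- Trace-free tensors are orthogonal to `I`; hence divergence-free fields see only the deviatoric
part of a stress. -/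
theorem frob_dev_left {B : Tensor d} (h : B.trace = 0) (A : Tensor d) :
    frob (dev A) B = frob A B := by
  rw [dev, frob_sub_left, frob_smul_left, frob_comm 1, frob_one, h, mul_zero, sub_zero]

/-! ### Affine fields on a simplex -/

theorem grad_apply (v : Space d →ᵃ[ℝ] Space d) (i j : Fin d) :
    grad v i j = v.linear (EuclideanSpace.single j 1) i := rfl

theorem act_grad (v : Space d →ᵃ[ℝ] Space d) (h : Space d) : act (grad v) h = v.linear h := by
  ext i
  conv_rhs => rw [← (EuclideanSpace.basisFun (Fin d) ℝ).sum_repr h]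
  rw [act_apply, map_sum, WithLp.ofLp_sum, Finset.sum_apply]
  refine Finset.sum_congr rfl fun j _ => ?_
  simp [grad_apply, mul_comm]

theorem trace_grad (v : Space d →ᵃ[ℝ] Space d) : (grad v).trace = vdiv v := rfl

theorem grad_add (v w : Space d →ᵃ[ℝ] Space d) : grad (v + w) = grad v + grad w := by
  ext i j; simp [grad_apply]

theorem grad_sub (v w : Space d →ᵃ[ℝ] Space d) : grad (v - w) = grad v - grad w := by
  ext i j; simp [grad_apply]

theorem vdiv_sub (v w : Space d →ᵃ[ℝ] Space d) : vdiv (v - w) = vdiv v - vdiv w := by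
  rw [← trace_grad, grad_sub, Matrix.trace_sub, trace_grad, trace_grad]

theorem vdiv_add (v w : Space d →ᵃ[ℝ] Space d) : vdiv (v + w) = vdiv v + vdiv w := by
  rw [← trace_grad, grad_add, Matrix.trace_add, trace_grad, trace_grad]

theorem tdiv_apply (τ : Space d →ᵃ[ℝ] Tensor d) (i : Fin d) :
    tdiv τ i = ∑ j, τ.linear (EuclideanSpace.single j 1) i j := rfl

theorem tdiv_sub (τ σ : Space d →ᵃ[ℝ] Tensor d) : tdiv (τ - σ) = tdiv τ - tdiv σ := by
  ext i; simp [tdiv_apply, Finset.sum_sub_distrib]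

theorem affineMap_apply_eq_linear_add {F : Type*} [AddCommGroup F] [Module ℝ F]
    (g : Space d →ᵃ[ℝ] F) (x y : Space d) : g x = g y + g.linear (x - y) := by
  have := g.map_vadd y (x - y)
  rw [vadd_eq_add, sub_add_cancel, vadd_eq_add] at this
  rw [this, add_comm]

/-- The affine tensor field `τ` has constant normal components on hyperplanes: its linear part is
`h ↦ (1/d) div τ ⊗ h`. -/
def IsRTShape (τ : Space d →ᵃ[ℝ] Tensor d) : Prop :=
  ∀ h, τ.linear h = (1 / (d : ℝ)) • dyad (tdiv τ) h

/-- The normal component of `τ`, scaled by `∇λ_P`, on the side of `T` opposite to `P`. -/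
def flux (τ : Space d →ᵃ[ℝ] Tensor d) (T : Finset (Space d)) (P : Space d) : Space d :=
  act (τ (centroid (T.erase P))) (baryGrad T P)

namespace IsSimplex

variable {T : Finset (Space d)} {P : Space d}

theorem linear_apply (hT : IsSimplex T) {F : Type*} [AddCommGroup F] [Module ℝ F]
    (g : Space d →ᵃ[ℝ] F) (h : Space d) :
    g.linear h = ∑ P ∈ T, inner ℝ (baryGrad T P) h • g P := by
  have e : g.linear h = g h - g 0 := by
    rw [affineMap_apply_eq_linear_add g h 0, sub_zero, add_sub_cancel_left]
  rw [e, hT.affineMap_apply g h, hT.affineMap_apply g 0, ← Finset.sum_sub_distrib]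
  refine Finset.sum_congr rfl fun P _ => ?_
  rw [← sub_smul, ← inner_baryGrad_sub, sub_zero]

theorem sum_inner_baryGrad (hT : IsSimplex T) (h : Space d) :
    ∑ P ∈ T, inner ℝ (baryGrad T P) h = 0 := by
  simpa using (hT.linear_apply (AffineMap.const ℝ (Space d) (1 : ℝ)) h).symm

theorem eq_of_inner_baryGrad (hT : IsSimplex T) {x y : Space d}
    (h : ∀ P ∈ T, inner ℝ (baryGrad T P) x = inner ℝ (baryGrad T P) y) : x = y := by
  have hx := hT.linear_apply (AffineMap.id ℝ (Space d)) x
  have hy := hT.linear_apply (AffineMap.id ℝ (Space d)) y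
  rw [Finset.sum_congr rfl fun P hP => by rw [h P hP], ← hy] at hx
  simpa using hx

/-- The edge `Q - O` spans the intersection of the directions of all sides except those opposite to
`Q` and `O`, so it is an eigenvector of `L`. The side opposite to `O` forces equal eigenvalues on
all edges from `O`, and these edges span. -/
theorem exists_eq_smul_of_side_preserving (hT : IsSimplex T) (L : Space d →ₗ[ℝ] Space d)
    (hL : ∀ P ∈ T, ∀ Q ∈ T.erase P, ∀ R ∈ T.erase P, inner ℝ (baryGrad T P) (L (Q - R)) = 0) :
    ∃ c : ℝ, ∀ h, L h = c • h := by
  obtain ⟨O, hO⟩ := hT.nonempty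
  -- The sign is chosen so that `c` is the eigenvalue, since `⟪∇λ_O, Q - O⟫ = -1`.
  obtain ⟨c, hc⟩ : ∃ c : ℝ, ∀ Q ∈ T.erase O, inner ℝ (baryGrad T O) (L (Q - O)) = -c := by
    rcases (T.erase O).eq_empty_or_nonempty with he | ⟨Q₀, hQ₀⟩
    · exact ⟨0, by simp [he]⟩
    · refine ⟨-inner ℝ (baryGrad T O) (L (Q₀ - O)), fun Q hQ => ?_⟩
      have := hL O hO Q hQ Q₀ hQ₀
      rw [show Q - Q₀ = (Q - O) - (Q₀ - O) by abel, map_sub, inner_sub_right] at this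
      linarith
  have hLQ : ∀ Q ∈ T, L (Q - O) = c • (Q - O) := by
    intro Q hQ
    by_cases hQO : Q = O
    · simp [hQO]
    have hQ' : Q ∈ T.erase O := Finset.mem_erase.2 ⟨hQO, hQ⟩
    have hother : ∀ P ∈ T, P ≠ Q → inner ℝ (baryGrad T P) (L (Q - O)) = c * inner ℝ (baryGrad T P) (Q - O) := by
      intro P hP hPQ
      rw [inner_baryGrad_sub, hT.bary_ne hP hQ hPQ]
      by_cases hPO : P = O
      · subst hPO
        rw [hc Q hQ', hT.bary_self hP]; ring
      · rw [hT.bary_ne hP hO hPO, hL P hP Q (Finset.mem_erase.2 ⟨Ne.symm hPQ, hQ⟩) O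
          (Finset.mem_erase.2 ⟨Ne.symm hPO, hO⟩)]; ring
    refine hT.eq_of_inner_baryGrad fun P hP => ?_
    rw [inner_smul_right]
    by_cases hPQ : P = Q
    -- The one component not controlled by the hypothesis follows from the others because the
    -- gradients `∇λ_P` sum to zero.
    · subst hPQ
      have h1 := hT.sum_inner_baryGrad (L (P - O))
      have h2 := hT.sum_inner_baryGrad (P - O)
      rw [← Finset.add_sum_erase _ _ hP] at h1 h2
      rw [Finset.sum_congr rfl fun R hR => hother R (Finset.mem_of_mem_erase hR)
        (Finset.ne_of_mem_erase hR), ← Finset.mul_sum] at h1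
      linear_combination h1 - c * h2
    · exact hother P hP hPQ
  refine ⟨c, fun h => ?_⟩
  have hh := hT.linear_apply (AffineMap.id ℝ (Space d) - AffineMap.const ℝ (Space d) O) h
  simp only [AffineMap.coe_sub, Pi.sub_apply, AffineMap.id_apply, AffineMap.const_apply,
    AffineMap.sub_linear, AffineMap.id_linear, AffineMap.const_linear, sub_zero, LinearMap.id_apply]
    at hh
  conv_lhs => rw [hh]
  conv_rhs => rw [hh]
  rw [map_sum, Finset.smul_sum]
  refine Finset.sum_congr rfl fun Q hQ => ?_
  rw [map_smul, hLQ Q hQ, smul_comm]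

/-- Constant normal components mean that each row of the linear part maps the direction of every
side into itself, hence is a multiple `c` of the identity. Taking the divergence of the row gives `d
c`. -/
theorem isRTShape (hT : IsSimplex T) (hd : d ≠ 0) {τ : Space d →ᵃ[ℝ] Tensor d}
    (hτ : ∀ P ∈ T, ∀ Q ∈ T.erase P, ∀ R ∈ T.erase P,
      act (τ Q) (baryGrad T P) = act (τ R) (baryGrad T P)) : IsRTShape τ := by
  have hd' : (d : ℝ) ≠ 0 := by exact_mod_cast hd
  have hrow : ∀ i, ∃ c : ℝ, ∀ h : Space d, ∀ j, τ.linear h i j = c * h j := by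
    intro i
    let L : Space d →ₗ[ℝ] Space d :=
      { toFun := fun h => WithLp.toLp 2 fun j => τ.linear h i j
        map_add' := fun x y => by ext j; simp
        map_smul' := fun r x => by ext j; simp }
    obtain ⟨c, hc⟩ := hT.exists_eq_smul_of_side_preserving L fun P hP Q hQ R hR => by
      have h := congrArg (fun x : Space d => x i) (hτ P hP Q hQ R hR)
      rw [affineMap_apply_eq_linear_add τ Q R, act_add] at h
      have h' : act (τ.linear (Q - R)) (baryGrad T P) i = 0 := by
        simpa using h
      rw [act_apply] at h'
      rw [inner_eq_sum, ← h']
      exact Finset.sum_congr rfl fun j _ => mul_comm _ _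
    exact ⟨c, fun h j => congrArg (fun x : Space d => x j) (hc h)⟩
  choose c hc using hrow
  intro h
  ext i j
  rw [Matrix.smul_apply, dyad, Matrix.of_apply, tdiv_apply, hc]
  simp_rw [hc]
  simp only [PiLp.single_apply, if_true, mul_one, Finset.sum_const, Finset.card_univ,
    Fintype.card_fin, nsmul_eq_mul, smul_eq_mul]
  field_simp

theorem apply_centroid_erase (hT : IsSimplex T) (hd : d ≠ 0) (hP : P ∈ T) {F : Type*}
    [AddCommGroup F] [Module ℝ F] (g : Space d →ᵃ[ℝ] F) :
    g (centroid (T.erase P)) = (d : ℝ)⁻¹ • (∑ Q ∈ T, g Q - g P) := by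
  rw [affineMap_centroid (hT.erase_nonempty hd hP), hT.card_erase hP, Finset.sum_erase_eq_sub hP]

theorem sum_apply_centroid_erase (hT : IsSimplex T) (hd : d ≠ 0) {F : Type*}
    [AddCommGroup F] [Module ℝ F] (g : Space d →ᵃ[ℝ] F) :
    ∑ P ∈ T, g (centroid (T.erase P)) = ∑ P ∈ T, g P := by
  have hd' : (d : ℝ) ≠ 0 := by exact_mod_cast hd
  rw [Finset.sum_congr rfl fun P hP => hT.apply_centroid_erase hd hP g, ← Finset.smul_sum,
    Finset.sum_sub_distrib, Finset.sum_const, hT.card_eq, ← Nat.cast_smul_eq_nsmul ℝ, Nat.cast_add,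
    Nat.cast_one, add_smul, one_smul, add_sub_cancel_right, smul_smul, inv_mul_cancel₀ hd', one_smul]

theorem apply_centroid (hT : IsSimplex T) (hd : d ≠ 0) {F : Type*} [AddCommGroup F] [Module ℝ F]
    (g : Space d →ᵃ[ℝ] F) :
    g (centroid T) = ((d : ℝ) + 1)⁻¹ • ∑ P ∈ T, g (centroid (T.erase P)) := by
  rw [hT.sum_apply_centroid_erase hd, affineMap_centroid hT.nonempty, hT.card_eq]
  push_cast
  rfl

/-- The function equal to one at the centroid opposite to `P` and zero at the other side centroids
is `1 - d λ_P`, with gradient `-d ∇λ_P`. -/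
theorem linear_apply_centroid_erase (hT : IsSimplex T) (hd : d ≠ 0) {F : Type*} [AddCommGroup F]
    [Module ℝ F] (g : Space d →ᵃ[ℝ] F) (h : Space d) :
    g.linear h = ∑ P ∈ T, (-(d : ℝ) * inner ℝ (baryGrad T P) h) • g (centroid (T.erase P)) := by
  have hd' : (d : ℝ) ≠ 0 := by exact_mod_cast hd
  have e : ∀ P ∈ T, (-(d : ℝ) * inner ℝ (baryGrad T P) h) • g (centroid (T.erase P))
      = inner ℝ (baryGrad T P) h • g P - inner ℝ (baryGrad T P) h • ∑ Q ∈ T, g Q := fun P hP => by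
    rw [hT.apply_centroid_erase hd hP, smul_smul, ← smul_sub, ← neg_sub (g P), smul_neg, ← neg_smul]
    congr 1
    field_simp
  rw [Finset.sum_congr rfl e, Finset.sum_sub_distrib, ← Finset.sum_smul, hT.sum_inner_baryGrad,
    zero_smul, sub_zero, hT.linear_apply]

theorem grad_eq (hT : IsSimplex T) (hd : d ≠ 0) (v : Space d →ᵃ[ℝ] Space d) :
    grad v = ∑ P ∈ T, (-(d : ℝ)) • dyad (v (centroid (T.erase P))) (baryGrad T P) := by
  ext i j
  rw [grad_apply, hT.linear_apply_centroid_erase hd v, WithLp.ofLp_sum, Finset.sum_apply,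
    Matrix.sum_apply]
  refine Finset.sum_congr rfl fun P _ => ?_
  rw [EuclideanSpace.inner_single_right]
  simp [dyad]
  ring

/-- From the centroid of `T` to that of the side, `λ_P` drops from `1/(d+1)` to `0`; the shape of
`τ` contributes the factor `1/d`. -/
theorem flux_eq (hT : IsSimplex T) (hd : d ≠ 0) (hP : P ∈ T) {τ : Space d →ᵃ[ℝ] Tensor d}
    (hτ : IsRTShape τ) : flux τ T P = act (τ (centroid T)) (baryGrad T P)
      - ((d : ℝ)⁻¹ * ((d : ℝ) + 1)⁻¹) • tdiv τ := by
  rw [flux, affineMap_apply_eq_linear_add τ (centroid (T.erase P)) (centroid T), act_add, hτ,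
    act_smul, act_dyad, real_inner_comm, inner_baryGrad_sub, hT.bary_centroid_erase hd hP hP,
    hT.bary_centroid hP, if_pos rfl, smul_smul]
  module

/-- Integration by parts on a simplex. -/
theorem frob_grad_add_inner_tdiv (hT : IsSimplex T) (hd : d ≠ 0) {τ : Space d →ᵃ[ℝ] Tensor d}
    (hτ : IsRTShape τ) (v : Space d →ᵃ[ℝ] Space d) :
    frob (τ (centroid T)) (grad v) + inner ℝ (tdiv τ) (v (centroid T))
      = -(d : ℝ) * ∑ P ∈ T, inner ℝ (flux τ T P) (v (centroid (T.erase P))) := by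
  have hd' : (d : ℝ) ≠ 0 := by exact_mod_cast hd
  -- Both terms are expanded in the side values of `v`; `d` times the constant in `flux_eq` is the
  -- weight `1/(d+1)` of a side value in `v (centroid T)`.
  rw [hT.grad_eq hd, frob_sum_right, hT.apply_centroid hd v, inner_smul_right, inner_sum,
    Finset.mul_sum, Finset.mul_sum, ← Finset.sum_add_distrib]
  refine Finset.sum_congr rfl fun P hP => ?_
  rw [frob_smul_right, frob_dyad, hT.flux_eq hd hP hτ, inner_sub_left, inner_smul_left,
    real_inner_comm (act _ _)]
  simp only [conj_trivial]
  field_simp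
  ring

end IsSimplex

/-- An affine tensor field of Raviart--Thomas shape has constant normal components on every side. -/
theorem IsRTShape.act_eq_flux {T : Finset (Space d)} {P x : Space d} (hT : IsSimplex T) (hd : d ≠ 0)
    (hP : P ∈ T) {τ : Space d →ᵃ[ℝ] Tensor d} (hτ : IsRTShape τ) (hx : x ∈ hull (T.erase P)) :
    act (τ x) (baryGrad T P) = flux τ T P := by
  rw [affineMap_apply_eq_linear_add τ x (centroid (T.erase P)), act_add, hτ, act_smul, act_dyad,
    real_inner_comm, inner_baryGrad_sub, hT.bary_eq_zero_of_mem_side hP hx,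
    hT.bary_eq_zero_of_mem_side hP (centroid_mem_hull (hT.erase_nonempty hd hP))]
  simp [flux]

end StokesCR
end

noncomputable section

namespace StokesCR

open scoped Classical

variable {d : ℕ} {Ω ΓD ΓN : Set (Space d)}

namespace Triangulation

variable {𝒯 : Triangulation d Ω} {T T' T₁ : 𝒯.cells} {P P' P₁ x : Space d}

/-! ### Integrals of element-wise polynomial fields -/

theorem setIntegral_hull (T : 𝒯.cells) (g : Space d →ᵃ[ℝ] ℝ) :
    ∫ x in hull T.1, g x = vol T.1 * g (centroid T.1) := by
  have h := (isSimplex T).setAverage_hull g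
  rw [setAverage_eq, smul_eq_mul] at h
  rw [← h, ← vol, mul_inv_cancel_left₀ (isSimplex T).vol_pos.ne']

theorem ipT_eq (A B : 𝒯.P0 (Tensor d)) : 𝒯.ipT A B = ∑ T, vol T.1 * frob (A T) (B T) :=
  Finset.sum_congr rfl fun T _ => by simp [vol]

theorem ip_cst_cst (v w : 𝒯.P0 (Space d)) :
    𝒯.ip (cst v) (cst w) = ∑ T, vol T.1 * inner ℝ (v T) (w T) :=
  Finset.sum_congr rfl fun T _ => by simp [vol, cst]

theorem ip_cst_fn (f : 𝒯.P0 (Space d)) (v : 𝒯.P1 (Space d)) :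
    𝒯.ip (cst f) (fn v) = ∑ T, vol T.1 * inner ℝ (f T) (v T (centroid T.1)) :=
  Finset.sum_congr rfl fun T _ =>
    setIntegral_hull T ((innerₛₗ ℝ (f T)).toAffineMap.comp (v T))

theorem proj_fn (v : 𝒯.P1 (Space d)) (T : 𝒯.cells) : proj (fn v) T = v T (centroid T.1) :=
  (isSimplex T).setAverage_hull (v T)

theorem projT_apply (τ : 𝒯.P1 (Tensor d)) (T : 𝒯.cells) : projT τ T = τ T (centroid T.1) := by
  ext i j
  exact (isSimplex T).setAverage_hull ((Matrix.entryLinearMap ℝ ℝ i j).toAffineMap.comp (τ T))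

theorem idSub_apply (T : 𝒯.cells) (x : Space d) : idSub T x = x - centroid T.1 := by
  rw [idSub]
  congr 1
  exact (isSimplex T).setAverage_hull (AffineMap.id ℝ (Space d))

/-! ### Crouzeix--Raviart and Raviart--Thomas fields through their degrees of freedom -/

theorem sideMean_erase (hd : d ≠ 0) (hP : P ∈ T.1) (g : Space d →ᵃ[ℝ] Space d) :
    sideMean (T.1.erase P) g = g (centroid (T.1.erase P)) :=
  sideMean_eq hd ((isSimplex T).card_erase hP) (affineIndependent_erase T P) g

/-- The jump is affine, so its mean over a side is its value at the centroid. -/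
theorem isCR_iff (hd : d ≠ 0) (v : 𝒯.P1 (Space d)) :
    IsCR v ↔ ∀ T P T' P', Adj T P T' P' →
      v T (centroid (T.1.erase P)) = v T' (centroid (T.1.erase P)) := by
  have key : ∀ (T T' : 𝒯.cells) (P : Space d), P ∈ T.1 →
      sideMean (T.1.erase P) (fun x => v T x - v T' x)
        = v T (centroid (T.1.erase P)) - v T' (centroid (T.1.erase P)) := fun T T' P hP =>
    sideMean_erase hd hP (v T - v T')
  constructor
  · intro h T P T' P' hadj
    have := h _ _ _ hadj.isInteriorSide
    rwa [key T T' P hadj.mem, sub_eq_zero] at this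
  · intro h S T T' hS
    obtain ⟨P, P', hadj, rfl⟩ := hS.exists_adj
    rw [key T T' P hadj.mem, sub_eq_zero]
    exact h T P T' P' hadj

theorem isCRD_iff (hd : d ≠ 0) (v : 𝒯.P1 (Space d)) :
    IsCRD ΓD v ↔ (∀ T P T' P', Adj T P T' P' →
        v T (centroid (T.1.erase P)) = v T' (centroid (T.1.erase P))) ∧
      ∀ T P, P ∈ T.1 → 𝒯.IsBoundarySideIn ΓD (T.1.erase P) T →
        v T (centroid (T.1.erase P)) = 0 := by
  rw [IsCRD, isCR_iff hd]
  refine and_congr_right fun _ => ⟨fun h T P hP hS => ?_, fun h S T hS => ?_⟩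
  · rw [← sideMean_erase hd hP]; exact h _ _ hS
  · obtain ⟨P, hP, rfl⟩ := exists_eq_erase hS.1.2.1 hS.1.1
    rw [sideMean_erase hd hP]; exact h T P hP hS

theorem IsCRD.sub (hd : d ≠ 0) {v w : 𝒯.P1 (Space d)} (hv : IsCRD ΓD v) (hw : IsCRD ΓD w) :
    IsCRD ΓD (v - w) := by
  rw [isCRD_iff hd] at *
  refine ⟨fun T P T' P' h => ?_, fun T P hP hS => ?_⟩
  · simp only [Pi.sub_apply, AffineMap.coe_sub]
    rw [hv.1 T P T' P' h, hw.1 T P T' P' h]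
  · simp only [Pi.sub_apply, AffineMap.coe_sub]
    rw [hv.2 T P hP hS, hw.2 T P hP hS, sub_zero]

/-- `|T| |∇λ_P|` is the same number from both simplices, so weighting by volumes or by unit normals
differs by one positive factor. -/
theorem Adj.flux_add_eq_zero_iff (hd : d ≠ 0) (h : Adj T P T' P') (a b : Space d) :
    vol T.1 • a + vol T'.1 • b = 0 ↔
      ‖baryGrad T.1 P‖⁻¹ • a + ‖baryGrad T'.1 P'‖⁻¹ • b = 0 := by
  have hv := (isSimplex T).vol_pos
  have hv' := (isSimplex T').vol_pos
  have hg := norm_pos_iff.2 ((isSimplex T).baryGrad_ne_zero hd h.mem)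
  have hg' := norm_pos_iff.2 ((isSimplex T').baryGrad_ne_zero hd h.mem')
  have hW := congrArg norm (h.vol_smul_baryGrad hd)
  rw [norm_neg, norm_smul, norm_smul, Real.norm_of_nonneg hv.le, Real.norm_of_nonneg hv'.le] at hW
  have e : vol T.1 • a + vol T'.1 • b
      = (vol T.1 * ‖baryGrad T.1 P‖) • (‖baryGrad T.1 P‖⁻¹ • a + ‖baryGrad T'.1 P'‖⁻¹ • b) := by
    rw [smul_add, smul_smul, smul_smul, mul_inv_cancel_right₀ hg.ne']
    conv_rhs => rw [← hW, mul_inv_cancel_right₀ hg'.ne']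
  rw [e, smul_eq_zero, or_iff_right (mul_pos hv hg).ne']

/-- Constant normal components amount to the Raviart–Thomas shape. Weighting fluxes by volume turns
normal continuity into the cancellation needed when sides are summed. -/
theorem isRTN_iff (hd : d ≠ 0) (τ : 𝒯.P1 (Tensor d)) :
    IsRTN ΓN τ ↔ (∀ T, IsRTShape (τ T)) ∧
      (∀ T P T' P', Adj T P T' P' →
        vol T.1 • flux (τ T) T.1 P + vol T'.1 • flux (τ T') T'.1 P' = 0) ∧
      ∀ T P, P ∈ T.1 → 𝒯.IsBoundarySideIn ΓN (T.1.erase P) T → flux (τ T) T.1 P = 0 := by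
  have hnorm : ∀ (T : 𝒯.cells) (P : Space d) (hP : P ∈ T.1), ‖baryGrad T.1 P‖⁻¹ ≠ 0 :=
    fun T P hP => inv_ne_zero (norm_ne_zero_iff.2 ((isSimplex T).baryGrad_ne_zero hd hP))
  have hout : ∀ (T : 𝒯.cells) (P : Space d) (hP : P ∈ T.1), IsOuterNormal T.1 (T.1.erase P)
      (-(‖baryGrad T.1 P‖⁻¹ • baryGrad T.1 P)) := fun T P hP =>
    ((isSimplex T).isOuterNormal_iff hd hP _).2 rfl
  have hm : ∀ (T : 𝒯.cells) (P : Space d) (hP : P ∈ T.1),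
      centroid (T.1.erase P) ∈ hull (T.1.erase P) := fun T P hP =>
    centroid_mem_hull ((isSimplex T).erase_nonempty hd hP)
  constructor
  · rintro ⟨⟨h1, h2⟩, h3⟩
    refine ⟨fun T => (isSimplex T).isRTShape hd fun P hP Q hQ R hR => ?_,
      fun T P T' P' h => (h.flux_add_eq_zero_iff hd _ _).2 ?_, fun T P hP hS => ?_⟩
    · have := h1 T _ _ (Finset.erase_subset P _) ((isSimplex T).card_erase hP) (hout T P hP)
        Q (subset_convexHull ℝ _ hQ) R (subset_convexHull ℝ _ hR)
      rw [act_neg_right, act_neg_right, neg_inj, act_smul_right, act_smul_right] at this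
      exact smul_right_injective _ (hnorm T P hP) this
    · have h2' := h2 _ T T' h.isInteriorSide _ _ (hout T P h.mem)
        (h.erase_eq ▸ hout T' P' h.mem') _ (hm T P h.mem)
      rw [act_neg_right, act_neg_right, act_smul_right, act_smul_right, ← neg_add,
        neg_eq_zero] at h2'
      rw [flux, flux, ← h.erase_eq]
      exact h2'
    · have := h3 _ T hS _ (hout T P hP) _ (hm T P hP)
      rw [act_neg_right, neg_eq_zero, act_smul_right, smul_eq_zero,
        or_iff_right (hnorm T P hP)] at this
      exact this
  · rintro ⟨h1, h2, h3⟩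
    have hside : ∀ (T : 𝒯.cells) (P x n : Space d), P ∈ T.1 → IsOuterNormal T.1 (T.1.erase P) n →
        x ∈ hull (T.1.erase P) →
        act (τ T x) n = -(‖baryGrad T.1 P‖⁻¹ • flux (τ T) T.1 P) := fun T P x n hP hn hx => by
      rw [((isSimplex T).isOuterNormal_iff hd hP n).1 hn, act_neg_right, act_smul_right,
        (h1 T).act_eq_flux (isSimplex T) hd hP hx]
    refine ⟨⟨fun T S n hS hc hn x hx y hy => ?_, fun S T T' hS n n' hn hn' x hx => ?_⟩,
      fun S T hS n hn x hx => ?_⟩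
    · obtain ⟨P, hP, rfl⟩ := exists_eq_erase hS hc
      rw [hside T P x n hP hn hx, hside T P y n hP hn hy]
    · obtain ⟨P, P', h, rfl⟩ := hS.exists_adj
      rw [hside T P x n h.mem hn hx, hside T' P' x n' h.mem' (h.erase_eq ▸ hn') (h.erase_eq ▸ hx),
        ← neg_add, neg_eq_zero]
      exact (h.flux_add_eq_zero_iff hd _ _).1 (h2 T P T' P' h)
    · obtain ⟨P, hP, rfl⟩ := exists_eq_erase hS.1.2.1 hS.1.1
      rw [hside T P x n hP hn hx, h3 T P hP hS, smul_zero, neg_zero]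

theorem flux_sub (τ σ : Space d →ᵃ[ℝ] Tensor d) (U : Finset (Space d)) (P : Space d) :
    flux (τ - σ) U P = flux τ U P - flux σ U P := by
  rw [flux, AffineMap.coe_sub, Pi.sub_apply, act_sub]; rfl

theorem IsRTN.sub (hd : d ≠ 0) {τ σ : 𝒯.P1 (Tensor d)} (hτ : IsRTN ΓN τ) (hσ : IsRTN ΓN σ) :
    IsRTN ΓN (τ - σ) := by
  rw [isRTN_iff hd] at *
  refine ⟨fun T h => ?_, fun T P T' P' h => ?_, fun T P hP hS => ?_⟩
  · rw [Pi.sub_apply, AffineMap.sub_linear, LinearMap.sub_apply, hτ.1 T, hσ.1 T, tdiv_sub,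
      ← smul_sub]
    congr 1
    ext i j
    simp [dyad, sub_mul]
  · rw [Pi.sub_apply, Pi.sub_apply, flux_sub, flux_sub]
    have e := congrArg₂ (· - ·) (hτ.2.1 T P T' P' h) (hσ.2.1 T P T' P' h)
    simp only [sub_zero] at e
    rw [← e]
    module
  · rw [Pi.sub_apply, flux_sub, hτ.2.2 T P hP hS, hσ.2.2 T P hP hS, sub_zero]

/-! ### Sums over sides -/

/-- An interior side arises from exactly two pairs (simplex, opposite vertex). This localises the
pairing with a field supported on one side. -/
theorem sum_side_of_adj (hd : d ≠ 0) (h : Adj T P T' P') (g : 𝒯.cells → Space d → ℝ) :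
    ∑ U : 𝒯.cells, ∑ Q ∈ U.1, (if U.1.erase Q = T.1.erase P then g U Q else 0)
      = g T P + g T' P' := by
  have huniq : ∀ (U : 𝒯.cells) (Q : Space d), Q ∈ U.1 → U.1.erase Q = T.1.erase P →
      (U = T ∧ Q = P) ∨ (U = T' ∧ Q = P') := fun U Q hQ e => by
    by_cases hU : U = T
    · subst hU
      refine Or.inl ⟨rfl, ?_⟩
      by_contra hne
      have : Q ∈ U.1.erase Q := by rw [e]; exact Finset.mem_erase.2 ⟨hne, hQ⟩
      simp at this
    · obtain ⟨h1, h2⟩ := h.unique hd (⟨Ne.symm hU, h.mem, hQ, e.symm⟩ : Adj T P U Q)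
      exact Or.inr ⟨h1.symm, h2.symm⟩
  rw [Finset.sum_sigma' Finset.univ (fun U : 𝒯.cells => U.1)]
  rw [Finset.sum_eq_add (⟨T, P⟩ : Σ _ : 𝒯.cells, Space d) ⟨T', P'⟩]
  · simp [h.erase_eq]
  · intro e
    exact h.ne (congrArg Sigma.fst e)
  · rintro ⟨U, Q⟩ hUQ ⟨h1, h2⟩
    refine if_neg fun e => ?_
    rcases huniq U Q (Finset.mem_sigma.1 hUQ).2 e with ⟨rfl, rfl⟩ | ⟨rfl, rfl⟩
    · exact h1 rfl
    · exact h2 rfl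
  · intro hn
    exact absurd (Finset.mem_sigma.2 ⟨Finset.mem_univ _, h.mem⟩) hn
  · intro hn
    exact absurd (Finset.mem_sigma.2 ⟨Finset.mem_univ _, h.mem'⟩) hn

theorem sum_side_of_not_adj (hP : P ∈ T.1) (h : ∀ T' P', ¬ Adj T P T' P')
    (g : 𝒯.cells → Space d → ℝ) :
    ∑ U : 𝒯.cells, ∑ Q ∈ U.1, (if U.1.erase Q = T.1.erase P then g U Q else 0) = g T P := by
  rw [Finset.sum_sigma' Finset.univ (fun U : 𝒯.cells => U.1)]
  rw [Finset.sum_eq_single (⟨T, P⟩ : Σ _ : 𝒯.cells, Space d)]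
  · simp
  · rintro ⟨U, Q⟩ hUQ h1
    have hQ := (Finset.mem_sigma.1 hUQ).2
    refine if_neg fun e => ?_
    by_cases hU : U = T
    · subst hU
      have hne : Q ≠ P := fun e' => h1 (by rw [e'])
      have : Q ∈ U.1.erase Q := by rw [e]; exact Finset.mem_erase.2 ⟨hne, hQ⟩
      simp at this
    · exact h U Q ⟨Ne.symm hU, hP, hQ, e.symm⟩
  · intro hn
    exact absurd (Finset.mem_sigma.2 ⟨Finset.mem_univ _, hP⟩) hn

/-- Passing to the neighbour across a side is an involution on pairs (simplex, opposite vertex);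
pairs without a neighbour are its fixed points. -/
theorem sum_eq_zero_of_adj (hd : d ≠ 0) (g : 𝒯.cells → Space d → ℝ)
    (hadj : ∀ T P T' P', Adj T P T' P' → g T P + g T' P' = 0)
    (hbd : ∀ T P, P ∈ T.1 → (∀ T' P', ¬ Adj T P T' P') → g T P = 0) :
    ∑ U : 𝒯.cells, ∑ Q ∈ U.1, g U Q = 0 := by
  rw [Finset.sum_sigma' Finset.univ (fun U : 𝒯.cells => U.1)]
  let s : (Σ _ : 𝒯.cells, Space d) → (Σ _ : 𝒯.cells, Space d) := fun a =>
    if h : ∃ b : Σ _ : 𝒯.cells, Space d, Adj a.1 a.2 b.1 b.2 then h.choose else a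
  have hs : ∀ a b : Σ _ : 𝒯.cells, Space d, Adj a.1 a.2 b.1 b.2 → s a = b := fun a b hab => by
    have hex : ∃ b : Σ _ : 𝒯.cells, Space d, Adj a.1 a.2 b.1 b.2 := ⟨b, hab⟩
    have e : s a = hex.choose := dif_pos hex
    obtain ⟨h1, h2⟩ := hex.choose_spec.unique hd hab
    rw [e]
    exact Sigma.ext h1 (heq_of_eq h2)
  have hs' : ∀ a : Σ _ : 𝒯.cells, Space d, (∃ b : Σ _ : 𝒯.cells, Space d, Adj a.1 a.2 b.1 b.2) ∨
      (s a = a ∧ ∀ T' P', ¬ Adj a.1 a.2 T' P') := fun a => by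
    by_cases h : ∃ b : Σ _ : 𝒯.cells, Space d, Adj a.1 a.2 b.1 b.2
    · exact Or.inl h
    · exact Or.inr ⟨dif_neg h, fun T' P' h' => h ⟨⟨T', P'⟩, h'⟩⟩
  refine Finset.sum_involution (fun a _ => s a) (fun a ha => ?_) (fun a ha hne => ?_)
    (fun a ha => ?_) (fun a ha => ?_)
  · rcases hs' a with ⟨b, hb⟩ | ⟨e, hn⟩
    · rw [hs a b hb]; exact hadj _ _ _ _ hb
    · rw [e, hbd a.1 a.2 (Finset.mem_sigma.1 ha).2 hn, add_zero]
  · rcases hs' a with ⟨b, hb⟩ | ⟨e, hn⟩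
    · rw [hs a b hb]
      rintro rfl
      exact hb.ne rfl
    · exact absurd (hbd a.1 a.2 (Finset.mem_sigma.1 ha).2 hn) hne
  · rcases hs' a with ⟨b, hb⟩ | ⟨e, hn⟩
    · rw [hs a b hb]; exact Finset.mem_sigma.2 ⟨Finset.mem_univ _, hb.mem'⟩
    · rw [e]; exact ha
  · rcases hs' a with ⟨b, hb⟩ | ⟨e, hn⟩
    · rw [hs a b hb]; exact hs b a hb.symm
    · rw [e, e]

/-! ### Discrete integration by parts -/

/-- The bilinear form `(Π_h τ, ∇_h v) + (div τ, Π_h v)`. -/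
def pairing (τ : 𝒯.P1 (Tensor d)) (v : 𝒯.P1 (Space d)) : ℝ :=
  ∑ T : 𝒯.cells, vol T.1 * (frob (τ T (centroid T.1)) (grad (v T))
    + inner ℝ (tdiv (τ T)) (v T (centroid T.1)))

theorem pairing_eq (hd : d ≠ 0) {τ : 𝒯.P1 (Tensor d)} (hτ : ∀ T, IsRTShape (τ T))
    (v : 𝒯.P1 (Space d)) : pairing τ v = -(d : ℝ) * ∑ T : 𝒯.cells, ∑ P ∈ T.1,
      vol T.1 * inner ℝ (flux (τ T) T.1 P) (v T (centroid (T.1.erase P))) := by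
  rw [pairing, Finset.mul_sum]
  refine Finset.sum_congr rfl fun T _ => ?_
  rw [(isSimplex T).frob_grad_add_inner_tdiv hd (hτ T), ← Finset.mul_sum]
  ring

/-- Discrete integration by parts. -/
theorem pairing_eq_zero (hd : d ≠ 0) (hΩ : IsLipschitzDomain Ω) (h𝒯 : 𝒯.Resolves ΓD ΓN)
    {τ : 𝒯.P1 (Tensor d)} (hτ : IsRTN ΓN τ) {v : 𝒯.P1 (Space d)} (hv : IsCRD ΓD v) :
    pairing τ v = 0 := by
  rw [isRTN_iff hd] at hτ
  rw [isCRD_iff hd] at hv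
  rw [pairing_eq hd hτ.1, sum_eq_zero_of_adj hd, mul_zero]
  -- Across an interior side the values of `v` agree and the weighted fluxes are opposite; on the
  -- boundary one of the two factors vanishes.
  · intro T P T' P' h
    rw [← h.erase_eq, ← hv.1 T P T' P' h, ← real_inner_smul_left, ← real_inner_smul_left,
      ← inner_add_left, hτ.2.1 T P T' P' h, inner_zero_left]
  · intro T P hP h
    rcases h𝒯 _ _ (isBoundarySide_of_not_adj hd hΩ hP h) with hS | hS
    · rw [hv.2 T P hP hS, inner_zero_right, mul_zero]
    · rw [hτ.2.2 T P hP hS, inner_zero_left, mul_zero]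

/-! ### Basis functions -/

theorem erase_injOn {U : Finset (Space d)} {P Q : Space d} (hQ : Q ∈ U)
    (h : U.erase P = U.erase Q) : P = Q := by
  by_contra hne
  have : Q ∈ U.erase Q := h ▸ Finset.mem_erase.2 ⟨Ne.symm hne, hQ⟩
  simp at this

/-- The Crouzeix--Raviart field with value `e` on the side `S` and `0` on all other sides. -/
theorem exists_crBasis (hd : d ≠ 0) (𝒯 : Triangulation d Ω) (S : Finset (Space d)) (e : Space d) :
    ∃ v : 𝒯.P1 (Space d), ∀ (T : 𝒯.cells) (P : Space d), P ∈ T.1 →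
      v T (centroid (T.1.erase P)) = if T.1.erase P = S then e else 0 := by
  have hd' : (d : ℝ) ≠ 0 := by exact_mod_cast hd
  have hT : ∀ T : 𝒯.cells, ∃ w : Space d →ᵃ[ℝ] Space d, ∀ P ∈ T.1,
      w (centroid (T.1.erase P)) = if T.1.erase P = S then e else 0 := fun T => by
    by_cases h : ∃ Q ∈ T.1, T.1.erase Q = S
    · obtain ⟨Q, hQ, rfl⟩ := h
      -- The field `(1 - d λ_Q) e`.
      refine ⟨((LinearMap.toSpanSingleton ℝ (Space d) e).toAffineMap.comp
        (AffineMap.const ℝ (Space d) (1 : ℝ) - (d : ℝ) • bary T.1 Q)), fun P hP => ?_⟩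
      simp only [AffineMap.comp_apply, LinearMap.coe_toAffineMap, LinearMap.toSpanSingleton_apply,
        AffineMap.coe_sub, Pi.sub_apply, AffineMap.const_apply, AffineMap.coe_smul, Pi.smul_apply,
        smul_eq_mul]
      rw [(isSimplex T).bary_centroid_erase hd hQ hP]
      by_cases hPQ : P = Q
      · simp [hPQ]
      · rw [if_neg (Ne.symm hPQ), if_neg fun h => hPQ (erase_injOn hQ h), mul_inv_cancel₀ hd',
          sub_self, zero_smul]
    · refine ⟨0, fun P hP => ?_⟩
      rw [if_neg fun e => h ⟨P, hP, e⟩]; rfl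
  choose v hv using hT
  exact ⟨v, hv⟩

theorem isCRD_crBasis (hd : d ≠ 0) {S : Finset (Space d)} {e : Space d} {v : 𝒯.P1 (Space d)}
    (hv : ∀ (T : 𝒯.cells) (P : Space d), P ∈ T.1 →
      v T (centroid (T.1.erase P)) = if T.1.erase P = S then e else 0)
    (hS : ∀ T, ¬ 𝒯.IsBoundarySideIn ΓD S T) : IsCRD ΓD v := by
  rw [isCRD_iff hd]
  refine ⟨fun T P T' P' h => ?_, fun T P hP hS' => ?_⟩
  · rw [hv T P h.mem, h.erase_eq, hv T' P' h.mem']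
  · rw [hv T P hP, if_neg fun h : T.1.erase P = S => hS T (h ▸ hS')]

/-- On a simplex, the affine field of Raviart--Thomas shape whose flux is `e` through the side
opposite to `Q` and `0` through all other sides. -/
theorem exists_rtShape (hd : d ≠ 0) {U : Finset (Space d)} (hU : IsSimplex U) {Q : Space d}
    (hQ : Q ∈ U) (e : Space d) :
    ∃ σ : Space d →ᵃ[ℝ] Tensor d, IsRTShape σ ∧
      ∀ P ∈ U, flux σ U P = if P = Q then e else 0 := by
  have hd' : (d : ℝ) ≠ 0 := by exact_mod_cast hd
  let L : Space d →ₗ[ℝ] Tensor d :=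
    { toFun := fun h => dyad (-e) h
      map_add' := dyad_add_right _
      map_smul' := fun r h => dyad_smul_right r _ h }
  -- For `σ(x) = -e ⊗ (x - Q)` the flux opposite to `P` is `λ_P(Q) e`, because `λ_P` vanishes on
  -- that side.
  let σ : Space d →ᵃ[ℝ] Tensor d :=
    L.toAffineMap.comp (AffineMap.id ℝ (Space d) - AffineMap.const ℝ (Space d) Q)
  have hlin : ∀ h, σ.linear h = dyad (-e) h := fun h => by
    simp [σ, L]
  refine ⟨σ, fun h => ?_, fun P hP => ?_⟩
  · have : tdiv σ = (d : ℝ) • (-e) := by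
      ext i
      rw [tdiv_apply]
      simp_rw [hlin]
      simp [dyad]
    rw [hlin, this, dyad_smul_left, smul_smul, one_div, inv_mul_cancel₀ hd', one_smul]
  · have : σ (centroid (U.erase P)) = dyad (-e) (centroid (U.erase P) - Q) := rfl
    rw [flux, this, act_dyad, real_inner_comm, inner_baryGrad_sub,
      hU.bary_centroid_erase hd hP hP, hU.bary_apply hP hQ]
    by_cases hPQ : P = Q <;> simp [hPQ]

/-- The Raviart--Thomas field with given flux through a side, oriented outwards of `T₀`. -/
theorem exists_rtBasis (hd : d ≠ 0) (𝒯 : Triangulation d Ω) (S : Finset (Space d)) (T₀ : 𝒯.cells)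
    (e : Space d) :
    ∃ σ : 𝒯.P1 (Tensor d), (∀ T, IsRTShape (σ T)) ∧ ∀ (T : 𝒯.cells) (P : Space d), P ∈ T.1 →
      vol T.1 • flux (σ T) T.1 P
        = if T.1.erase P = S then (if T = T₀ then (1 : ℝ) else -1) • e else 0 := by
  have hT : ∀ T : 𝒯.cells, ∃ σ : Space d →ᵃ[ℝ] Tensor d, IsRTShape σ ∧ ∀ P ∈ T.1,
      vol T.1 • flux σ T.1 P
        = if T.1.erase P = S then (if T = T₀ then (1 : ℝ) else -1) • e else 0 := fun T => by
    by_cases h : ∃ Q ∈ T.1, T.1.erase Q = S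
    · obtain ⟨Q, hQ, rfl⟩ := h
      obtain ⟨σ, hσ, hfl⟩ := exists_rtShape hd (isSimplex T) hQ
        ((vol T.1)⁻¹ • (if T = T₀ then (1 : ℝ) else -1) • e)
      refine ⟨σ, hσ, fun P hP => ?_⟩
      rw [hfl P hP]
      by_cases hPQ : P = Q
      · rw [if_pos hPQ, if_pos (congrArg T.1.erase hPQ), smul_inv_smul₀ (isSimplex T).vol_pos.ne']
      · rw [if_neg hPQ, if_neg fun h => hPQ (erase_injOn hQ h), smul_zero]
    · refine ⟨0, fun x => ?_, fun P hP => ?_⟩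
      · ext i j
        simp [dyad, tdiv_apply]
      · rw [if_neg fun e => h ⟨P, hP, e⟩, flux]
        have : (0 : Space d →ᵃ[ℝ] Tensor d) (centroid (T.1.erase P)) = 0 := rfl
        rw [this, act_zero, smul_zero]
  choose σ hσ using hT
  exact ⟨σ, fun T => (hσ T).1, fun T => (hσ T).2⟩

theorem isRTN_rtBasis (hd : d ≠ 0) {T₀ : 𝒯.cells} {P₀ e : Space d} (hP₀ : P₀ ∈ T₀.1)
    {σ : 𝒯.P1 (Tensor d)} (hσ : ∀ T, IsRTShape (σ T))
    (hfl : ∀ (T : 𝒯.cells) (P : Space d), P ∈ T.1 → vol T.1 • flux (σ T) T.1 P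
      = if T.1.erase P = T₀.1.erase P₀ then (if T = T₀ then (1 : ℝ) else -1) • e else 0)
    (hS : ∀ T, ¬ 𝒯.IsBoundarySideIn ΓN (T₀.1.erase P₀) T) : IsRTN ΓN σ := by
  rw [isRTN_iff hd]
  refine ⟨hσ, fun T P T' P' h => ?_, fun T P hP hS' => ?_⟩
  · rw [hfl T P h.mem, hfl T' P' h.mem', ← h.erase_eq]
    by_cases hPS : T.1.erase P = T₀.1.erase P₀
    · rw [if_pos hPS, if_pos hPS]
      by_cases hT : T = T₀
      · have hT' : T' ≠ T₀ := fun e => h.ne (hT.trans e.symm)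
        rw [if_pos hT, if_neg hT', ← add_smul]; simp
      · have hT' : T' = T₀ := (h.unique hd (⟨hT, h.mem, hP₀, hPS⟩ : Adj T P T₀ P₀)).1
        rw [if_neg hT, if_pos hT', ← add_smul]; simp
    · rw [if_neg hPS, if_neg hPS, add_zero]
  · have := hfl T P hP
    rw [if_neg fun h : T.1.erase P = T₀.1.erase P₀ => hS T (h ▸ hS'), smul_eq_zero,
      or_iff_right (isSimplex T).vol_pos.ne'] at this
    exact this

theorem Adj.not_isBoundarySideIn (hd : d ≠ 0) (hΩ : IsLipschitzDomain Ω) (h : Adj T P T' P')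
    {Γ : Set (Space d)} (U : 𝒯.cells) : ¬ 𝒯.IsBoundarySideIn Γ (T.1.erase P) U := fun hS =>
  h.not_hull_subset_frontier hd hΩ hS.1.2.2

/-- A field of Raviart--Thomas shape that is orthogonal to the Crouzeix--Raviart space is a
Raviart--Thomas field. -/
theorem isRTN_of_pairing_eq_zero (hd : d ≠ 0) (hΩ : IsLipschitzDomain Ω) (hΓ : Disjoint ΓD ΓN)
    {τ : 𝒯.P1 (Tensor d)} (hτ : ∀ T, IsRTShape (τ T))
    (h : ∀ v : 𝒯.P1 (Space d), IsCRD ΓD v → pairing τ v = 0) : IsRTN ΓN τ := by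
  have hd' : -(d : ℝ) ≠ 0 := neg_ne_zero.2 (by exact_mod_cast hd)
  have key : ∀ (S : Finset (Space d)) (e : Space d), (∀ T, ¬ 𝒯.IsBoundarySideIn ΓD S T) →
      ∑ U : 𝒯.cells, ∑ Q ∈ U.1, (if U.1.erase Q = S then
        inner ℝ (vol U.1 • flux (τ U) U.1 Q) e else 0) = 0 := fun S e hS => by
    obtain ⟨v, hv⟩ := exists_crBasis hd 𝒯 S e
    have h0 := h v (isCRD_crBasis hd hv hS)
    rw [pairing_eq hd hτ, mul_eq_zero, or_iff_right hd'] at h0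
    refine Eq.trans ?_ h0
    refine Finset.sum_congr rfl fun U _ => Finset.sum_congr rfl fun Q hQ => ?_
    rw [hv U Q hQ]
    split_ifs <;> simp [real_inner_smul_left]
  rw [isRTN_iff hd]
  refine ⟨hτ, fun T P T' P' hadj => ?_, fun T P hP hS => ?_⟩
  · refine ext_inner_right ℝ fun e => ?_
    have := key (T.1.erase P) e fun U => hadj.not_isBoundarySideIn hd hΩ U
    rw [sum_side_of_adj hd hadj fun U Q => inner ℝ (vol U.1 • flux (τ U) U.1 Q) e] at this
    rw [inner_add_left, this, inner_zero_left]
  · have hz : vol T.1 • flux (τ T) T.1 P = 0 := by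
      refine ext_inner_right ℝ fun e => ?_
      have := key (T.1.erase P) e fun U hU =>
        hU.not_of_disjoint hΓ ((isSimplex T).erase_nonempty hd hP) hS
      rw [sum_side_of_not_adj hP (fun T' P' => IsBoundarySide.not_adj hd hΩ hS.1)
        fun U Q => inner ℝ (vol U.1 • flux (τ U) U.1 Q) e] at this
      rw [this, inner_zero_left]
    rwa [smul_eq_zero, or_iff_right (isSimplex T).vol_pos.ne'] at hz

/-- An element-wise affine vector field that is orthogonal to the Raviart--Thomas space is a
Crouzeix--Raviart field. -/
theorem isCRD_of_pairing_eq_zero (hd : d ≠ 0) (hΩ : IsLipschitzDomain Ω) (hΓ : Disjoint ΓD ΓN)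
    {u : 𝒯.P1 (Space d)} (h : ∀ σ : 𝒯.P1 (Tensor d), IsRTN ΓN σ → pairing σ u = 0) :
    IsCRD ΓD u := by
  have hd' : -(d : ℝ) ≠ 0 := neg_ne_zero.2 (by exact_mod_cast hd)
  have key : ∀ (T₀ : 𝒯.cells) (P₀ e : Space d), P₀ ∈ T₀.1 →
      (∀ T, ¬ 𝒯.IsBoundarySideIn ΓN (T₀.1.erase P₀) T) →
      ∑ U : 𝒯.cells, ∑ Q ∈ U.1, (if U.1.erase Q = T₀.1.erase P₀ then
        inner ℝ ((if U = T₀ then (1 : ℝ) else -1) • e) (u U (centroid (T₀.1.erase P₀))) else 0)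
        = 0 := fun T₀ P₀ e hP₀ hS => by
    obtain ⟨σ, hσ, hfl⟩ := exists_rtBasis hd 𝒯 (T₀.1.erase P₀) T₀ e
    have h0 := h σ (isRTN_rtBasis hd hP₀ hσ hfl hS)
    rw [pairing_eq hd hσ, mul_eq_zero, or_iff_right hd'] at h0
    refine Eq.trans ?_ h0
    refine Finset.sum_congr rfl fun U _ => Finset.sum_congr rfl fun Q hQ => ?_
    rw [← real_inner_smul_left (flux _ _ _), hfl U Q hQ]
    by_cases e' : U.1.erase Q = T₀.1.erase P₀
    · rw [if_pos e', if_pos e', e']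
    · rw [if_neg e', if_neg e', inner_zero_left]
  rw [isCRD_iff hd]
  refine ⟨fun T P T' P' hadj => ?_, fun T P hP hS => ?_⟩
  · refine ext_inner_left ℝ fun e => ?_
    -- The fluxes of the test field have opposite signs in `T` and `T'`, so the difference of the
    -- two traces appears.
    have := key T P e hadj.mem fun U => hadj.not_isBoundarySideIn hd hΩ U
    rw [sum_side_of_adj hd hadj fun U Q => inner ℝ ((if U = T then (1 : ℝ) else -1) • e)
      (u U (centroid (T.1.erase P))), if_pos rfl, if_neg hadj.ne.symm, one_smul, neg_one_smul,
      inner_neg_left] at this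
    linarith
  · refine ext_inner_left ℝ fun e => ?_
    have := key T P e hP fun U hU => hS.not_of_disjoint hΓ
      ((isSimplex T).erase_nonempty hd hP) hU
    rw [sum_side_of_not_adj hP (fun T' P' => IsBoundarySide.not_adj hd hΩ hS.1)
      fun U Q => inner ℝ ((if U = T then (1 : ℝ) else -1) • e)
      (u U (centroid (T.1.erase P))), if_pos rfl, one_smul] at this
    rw [this, inner_zero_right]

end Triangulation
end StokesCR
end

/-! ### The discrete Stokes problems: energies, rigidity, reconstruction -/

noncomputable section

namespace StokesCR

open scoped Classical

variable {d : ℕ} {Ω ΓD ΓN : Set (Space d)}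

namespace Triangulation

variable {𝒯 : Triangulation d Ω} {ν : ℝ} {f : 𝒯.P0 (Space d)} {F : 𝒯.P0 (Tensor d)}
  {uD u v : 𝒯.P1 (Space d)} {τ σ : 𝒯.P1 (Tensor d)}

theorem subConst_apply_centroid (τ : 𝒯.P1 (Tensor d)) (F : 𝒯.P0 (Tensor d)) (T : 𝒯.cells) :
    subConst τ F T (centroid T.1) = projT τ T - F T := by
  rw [projT_apply]; rfl

theorem tdivh_subConst (τ : 𝒯.P1 (Tensor d)) (F : 𝒯.P0 (Tensor d)) :
    tdivh (subConst τ F) = tdivh τ := by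
  ext T i
  simp [tdivh, subConst, tdiv_apply]

theorem subConst_sub_subConst (τ σ : 𝒯.P1 (Tensor d)) (F : 𝒯.P0 (Tensor d)) :
    subConst σ F - subConst τ F = σ - τ := by
  funext T
  simp only [subConst, Pi.sub_apply]
  abel

theorem projT_sub (σ τ : 𝒯.P1 (Tensor d)) (T : 𝒯.cells) :
    projT (σ - τ) T = projT σ T - projT τ T := by
  rw [projT_apply, projT_apply, projT_apply]; rfl

theorem IsAdmissibleStress.isRTN_sub (hd : d ≠ 0) (hσ : IsAdmissibleStress ΓN f F σ)
    (hτ : IsAdmissibleStress ΓN f F τ) : IsRTN ΓN (σ - τ) := by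
  rw [← subConst_sub_subConst τ σ F]
  exact hσ.1.sub hd hτ.1

theorem IsAdmissibleStress.tdiv_sub_eq_zero (hσ : IsAdmissibleStress ΓN f F σ)
    (hτ : IsAdmissibleStress ΓN f F τ) (T : 𝒯.cells) : tdiv ((σ - τ) T) = 0 := by
  have h1 := congrFun ((tdivh_subConst σ F).symm.trans hσ.2) T
  have h2 := congrFun ((tdivh_subConst τ F).symm.trans hτ.2) T
  rw [Pi.sub_apply, tdiv_sub]
  simp only [tdivh] at h1 h2
  rw [h1, h2, sub_self]

theorem ipT_self_nonneg (A : 𝒯.P0 (Tensor d)) : 0 ≤ 𝒯.ipT A A := by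
  rw [ipT_eq]
  exact Finset.sum_nonneg fun T _ => mul_nonneg (isSimplex T).vol_pos.le (frob_self_nonneg _)

theorem eq_zero_of_ipT_self_nonpos {A : 𝒯.P0 (Tensor d)} (h : 𝒯.ipT A A ≤ 0) (T : 𝒯.cells) :
    A T = 0 := by
  have h0 := le_antisymm h (ipT_self_nonneg A)
  rw [ipT_eq, Finset.sum_eq_zero_iff_of_nonneg fun T _ =>
    mul_nonneg (isSimplex T).vol_pos.le (frob_self_nonneg _)] at h0
  have := h0 T (Finset.mem_univ T)
  rw [mul_eq_zero, or_iff_right (isSimplex T).vol_pos.ne'] at this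
  exact frob_self_eq_zero this

/-! ### Energies of a compatible pair -/

/-- The value of the primal energy functional on divergence-free fields. -/
def primalValue (ν : ℝ) (f : 𝒯.P0 (Space d)) (F : 𝒯.P0 (Tensor d)) (uD v : 𝒯.P1 (Space d)) : ℝ :=
  ν / 2 * 𝒯.ipT (gradh (v + uD)) (gradh (v + uD)) - 𝒯.ip (cst f) (cst (proj (fn v)))
    - 𝒯.ipT F (gradh v)

theorem primalEnergy_of_divh (hv : divh v = 0) :
    primalEnergy ν f F uD v = (primalValue ν f F uD v : EReal) := if_pos hv

theorem primalEnergy_of_divh_ne (hv : divh v ≠ 0) : primalEnergy ν f F uD v = ⊤ := if_neg hv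

/-- The value of the dual energy functional on admissible stresses. -/
def dualValue (ν : ℝ) (uD : 𝒯.P1 (Space d)) (τ : 𝒯.P1 (Tensor d)) : ℝ :=
  -(1 / (2 * ν)) * 𝒯.ipT (devh (projT τ)) (devh (projT τ)) + 𝒯.ipT (devh (projT τ)) (gradh uD)

theorem dualEnergy_of_tdivh (h : tdivh (subConst τ F) = -f) :
    dualEnergy ν f F uD τ = (dualValue ν uD τ : EReal) := if_pos h

theorem dualEnergy_of_tdivh_ne (h : tdivh (subConst τ F) ≠ -f) :
    dualEnergy ν f F uD τ = ⊥ := if_neg h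

/-- If `dev Π_h τ = ν ∇_h (u + û_D)` for an admissible `τ`, then `u` is the vertex of the primal
energy. -/
theorem primalValue_eq (hd : d ≠ 0) (hΩ : IsLipschitzDomain Ω) (h𝒯 : 𝒯.Resolves ΓD ΓN)
    (hτ : IsAdmissibleStress ΓN f F τ) (hτu : ∀ T, dev (projT τ T) = ν • grad ((u + uD) T))
    (hu : IsCRD ΓD u) (hu0 : divh u = 0) (hv : IsCRD ΓD v) (hv0 : divh v = 0) :
    primalValue ν f F uD v
      = primalValue ν f F uD u + ν / 2 * 𝒯.ipT (gradh (v - u)) (gradh (v - u)) := by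
  -- This identity is the vanishing of the first variation of the primal energy in the direction `v
  -- - u`.
  have hp := pairing_eq_zero hd hΩ h𝒯 hτ.1 (hv.sub hd hu)
  rw [← sub_eq_zero, ← hp]
  simp only [primalValue, ipT_eq, ip_cst_cst, proj_fn, pairing, Finset.mul_sum,
    ← Finset.sum_sub_distrib, ← Finset.sum_add_distrib]
  refine Finset.sum_congr rfl fun T _ => ?_
  have htr : (grad ((v - u) T)).trace = 0 := by
    have h1 := congrFun hv0 T
    have h2 := congrFun hu0 T
    simp only [divh, Pi.zero_apply] at h1 h2
    rw [trace_grad, Pi.sub_apply, vdiv_sub, h1, h2, sub_zero]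
  have hdev : frob (projT τ T) (grad ((v - u) T))
      = ν * frob (grad ((u + uD) T)) (grad ((v - u) T)) := by
    rw [← frob_dev_left htr, hτu T, frob_smul_left]
  have hdiv : tdiv (subConst τ F T) = -f T := congrFun hτ.2 T
  have hg : grad ((v + uD) T) = grad ((u + uD) T) + grad ((v - u) T) := by
    rw [← grad_add]; congr 1; simp only [Pi.add_apply, Pi.sub_apply]; abel
  have hg' : grad (v T) = grad (u T) + grad ((v - u) T) := by
    rw [← grad_add]; congr 1; simp only [Pi.sub_apply]; abel
  have hc : (v - u) T (centroid T.1) = v T (centroid T.1) - u T (centroid T.1) := rfl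
  simp only [gradh]
  rw [subConst_apply_centroid, hdiv, frob_sub_left, hdev, hg, hg', hc, inner_neg_left,
    inner_sub_right]
  simp only [frob_add_left, frob_add_right]
  rw [frob_comm (grad ((v - u) T)) (grad ((u + uD) T))]
  ring

/-- If `dev Π_h τ = ν ∇_h (u + û_D)` for an admissible `u`, then `τ` is the vertex of the dual
energy. -/
theorem dualValue_eq (hd : d ≠ 0) (hΩ : IsLipschitzDomain Ω) (h𝒯 : 𝒯.Resolves ΓD ΓN) (hν : 0 < ν)
    (hτ : IsAdmissibleStress ΓN f F τ) (hτu : ∀ T, dev (projT τ T) = ν • grad ((u + uD) T))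
    (hu : IsCRD ΓD u) (hu0 : divh u = 0) (hσ : IsAdmissibleStress ΓN f F σ) :
    dualValue ν uD σ = dualValue ν uD τ
      - 1 / (2 * ν) * 𝒯.ipT (devh (projT (σ - τ))) (devh (projT (σ - τ))) := by
  -- Since `σ - τ` is divergence-free, this says that `(dev Π_h(σ - τ), ∇_h u) = 0`, which is the
  -- first-order term.
  have hp := pairing_eq_zero hd hΩ h𝒯 (hσ.isRTN_sub hd hτ) hu
  rw [← sub_eq_zero, ← neg_eq_zero, ← hp]
  simp only [dualValue, ipT_eq, pairing, Finset.mul_sum, ← Finset.sum_sub_distrib,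
    ← Finset.sum_add_distrib, ← Finset.sum_neg_distrib]
  refine Finset.sum_congr rfl fun T _ => ?_
  have htr : (grad (u T)).trace = 0 := congrFun hu0 T
  have hg : grad ((u + uD) T) = grad (u T) + grad (uD T) := by rw [← grad_add]; rfl
  have hs : projT σ T = projT τ T + projT (σ - τ) T := by rw [projT_sub]; abel
  rw [hσ.tdiv_sub_eq_zero hτ, inner_zero_left, add_zero, ← projT_apply,
    ← frob_dev_left htr (projT (σ - τ) T)]
  simp only [devh, gradh]
  rw [hs, dev_add, hτu T, hg]
  simp only [frob_add_left, frob_add_right, frob_smul_left, frob_smul_right]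
  rw [frob_comm (grad (u T)) (dev (projT (σ - τ) T)),
    frob_comm (grad (uD T)) (dev (projT (σ - τ) T))]
  field_simp
  ring

/-! ### Rigidity -/

theorem nonempty_cells (hΩ : IsLipschitzDomain Ω) (𝒯 : Triangulation d Ω) : Nonempty 𝒯.cells := by
  obtain ⟨x, hx⟩ := hΩ.isConnected.nonempty
  obtain ⟨T, -⟩ := exists_mem_hull 𝒯 (subset_closure hx)
  exact ⟨T⟩

/-- A Crouzeix--Raviart field with vanishing gradient and a Dirichlet side vanishes. -/
theorem IsCRD.eq_zero_of_grad (hd : d ≠ 0) (hΩ : IsLipschitzDomain Ω)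
    (hΓ : IsBoundaryPartition Ω ΓD ΓN) (h𝒯 : 𝒯.Resolves ΓD ΓN) (hv : IsCRD ΓD v)
    (hg : ∀ T, grad (v T) = 0) : v = 0 := by
  have hconst : ∀ T x y, v T x = v T y := fun T x y => by
    rw [affineMap_apply_eq_linear_add (v T) x y, ← act_grad, hg T, act_zero, add_zero]
  rw [isCRD_iff hd] at hv
  obtain ⟨T₀, P₀, hP₀, hS⟩ := exists_isBoundarySideIn hd hΩ 𝒯 hΓ.disjoint hΓ.relOpen_D
    hΓ.nonempty_D h𝒯
  have hall := forall_of_adj hΩ (fun T => ∀ x, v T x = 0) (fun T P T' P' h hT x => by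
    rw [hconst T' x (centroid (T.1.erase P)), ← hv.1 T P T' P' h, hT]) (T₀ := T₀)
    fun x => by rw [hconst T₀ x (centroid (T₀.1.erase P₀)), hv.2 T₀ P₀ hP₀ hS]
  funext T
  ext1 x
  exact hall T x

/-- A divergence-free Raviart--Thomas field with vanishing deviatoric part is a multiple of the
identity. -/
theorem IsRTN.eq_smul_one (hd : d ≠ 0) (hΩ : IsLipschitzDomain Ω)
    (hΓ : IsBoundaryPartition Ω ΓD ΓN) (h𝒯 : 𝒯.Resolves ΓD ΓN) (hτ : IsRTN ΓN τ)
    (hdiv : ∀ T, tdiv (τ T) = 0) (hdev : ∀ T, dev (projT τ T) = 0) :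
    ∃ c : ℝ, (ΓN.Nonempty → c = 0) ∧ ∀ T x, τ T x = c • (1 : Tensor d) := by
  rw [isRTN_iff hd] at hτ
  obtain ⟨q, hq⟩ : ∃ q : 𝒯.P0 ℝ, ∀ T x, τ T x = q T • (1 : Tensor d) := by
    refine ⟨fun T => (projT τ T).trace / d, fun T x => ?_⟩
    have hlin : (τ T).linear (x - centroid T.1) = 0 := by
      rw [hτ.1 T, hdiv T]
      ext i j
      simp [dyad]
    rw [affineMap_apply_eq_linear_add (τ T) x (centroid T.1), hlin, add_zero, ← projT_apply]
    exact sub_eq_zero.1 (hdev T)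
  have hflux : ∀ T P, flux (τ T) T.1 P = q T • baryGrad T.1 P := fun T P => by
    rw [flux, hq, act_smul, act_one]
  obtain ⟨T₀⟩ := nonempty_cells hΩ 𝒯
  -- The flux of `q I` is `q ∇λ_P`; as `|T| ∇λ_P` changes sign across a side, normal continuity
  -- forces equal values of `q`.
  have hall := forall_of_adj hΩ (fun T => q T = q T₀) (fun T P T' P' h hT => by
    have h1 := hτ.2.1 T P T' P' h
    rw [hflux, hflux, smul_comm, smul_comm (vol T'.1), h.vol_smul_baryGrad hd, smul_neg,
      ← sub_eq_add_neg, ← sub_smul, smul_smul, smul_eq_zero,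
      or_iff_left ((isSimplex T).baryGrad_ne_zero hd h.mem), mul_eq_zero,
      or_iff_left (isSimplex T).vol_pos.ne', sub_eq_zero] at h1
    rw [← h1, hT]) (T₀ := T₀) rfl
  refine ⟨q T₀, fun hN => ?_, fun T x => by rw [hq, hall T]⟩
  obtain ⟨T, P, hP, hS⟩ := exists_isBoundarySideIn hd hΩ 𝒯 hΓ.disjoint.symm hΓ.relOpen_N hN
    fun S T hS => (h𝒯 S T hS).symm
  have h1 := hτ.2.2 T P hP hS
  rw [hflux, smul_eq_zero, or_iff_left ((isSimplex T).baryGrad_ne_zero hd hP)] at h1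
  rw [← hall T, h1]

/-! ### Reconstruction of the stress and of the velocity -/

/-- The element-wise affine tensor field with mean values `A` and divergence `-f`. -/
theorem exists_stress (hd : d ≠ 0) (A : 𝒯.P0 (Tensor d)) (f : 𝒯.P0 (Space d)) :
    ∃ τ : 𝒯.P1 (Tensor d), (∀ T x, τ T x = A T - (1 / (d : ℝ)) • dyad (f T) (idSub T x)) ∧
      (∀ T, projT τ T = A T) ∧ (∀ T, tdiv (τ T) = -f T) ∧
      ∀ T h, (τ T).linear h = (1 / (d : ℝ)) • dyad (-f T) h := by
  have hd' : (d : ℝ) ≠ 0 := by exact_mod_cast hd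
  let L : 𝒯.cells → Space d →ₗ[ℝ] Tensor d := fun T =>
    { toFun := fun h => (1 / (d : ℝ)) • dyad (-f T) h
      map_add' := fun x y => by rw [dyad_add_right, smul_add]
      map_smul' := fun r h => by rw [dyad_smul_right, smul_comm]; rfl }
  let τ : 𝒯.P1 (Tensor d) := fun T => AffineMap.const ℝ (Space d) (A T) +
    (L T).toAffineMap.comp (AffineMap.id ℝ (Space d) - AffineMap.const ℝ (Space d) (centroid T.1))
  have hτ : ∀ T x, τ T x = A T - (1 / (d : ℝ)) • dyad (f T) (idSub T x) := fun T x => by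
    have : τ T x = A T + (1 / (d : ℝ)) • dyad (-f T) (x - centroid T.1) := rfl
    rw [this, dyad_neg_left, smul_neg, ← sub_eq_add_neg, idSub_apply]
  have hlin : ∀ T h, (τ T).linear h = (1 / (d : ℝ)) • dyad (-f T) h := fun T h => by
    simp [τ, L]
  refine ⟨τ, hτ, fun T => ?_, fun T => ?_, hlin⟩
  · rw [projT_apply, hτ, idSub_apply, sub_self]
    ext i j
    simp [dyad]
  · ext i
    rw [tdiv_apply]
    simp_rw [hlin]
    simp [dyad]
    field_simp

/-- The element-wise affine vector field with mean values `w` and gradient `G`. -/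
theorem exists_velocity (w : 𝒯.P0 (Space d)) (G : 𝒯.P0 (Tensor d)) :
    ∃ u : 𝒯.P1 (Space d), (∀ T x, u T x = w T + act (G T) (idSub T x)) ∧
      (∀ T, u T (centroid T.1) = w T) ∧ ∀ T, grad (u T) = G T := by
  let L : 𝒯.cells → Space d →ₗ[ℝ] Space d := fun T =>
    { toFun := act (G T)
      map_add' := act_add_right _
      map_smul' := fun r h => act_smul_right r _ h }
  let u : 𝒯.P1 (Space d) := fun T => AffineMap.const ℝ (Space d) (w T) +
    (L T).toAffineMap.comp (AffineMap.id ℝ (Space d) - AffineMap.const ℝ (Space d) (centroid T.1))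
  have hu : ∀ T x, u T x = w T + act (G T) (x - centroid T.1) := fun T x => rfl
  refine ⟨u, fun T x => by rw [hu, idSub_apply], fun T => ?_, fun T => ?_⟩
  · rw [hu, sub_self]
    ext i
    simp [act_apply]
  · ext i j
    have : (u T).linear (EuclideanSpace.single j 1) = act (G T) (EuclideanSpace.single j 1) := by
      simp [u, L]
    rw [grad_apply, this, act_apply]
    simp

end Triangulation
end StokesCR
end

/-! ### Proof of the proposition -/

open StokesCR Triangulation in
theorem proposition3p1 (d : ℕ) (hd : 2 ≤ d) (Ω ΓD ΓN : Set (Space d))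
    (hΩ : IsLipschitzDomain Ω) (hΓ : IsBoundaryPartition Ω ΓD ΓN)
    (𝒯 : Triangulation d Ω) (h𝒯 : 𝒯.Resolves ΓD ΓN)
    (ν : ℝ) (hν : 0 < ν) (f : 𝒯.P0 (Space d)) (F : 𝒯.P0 (Tensor d))
    (uD : 𝒯.P1 (Space d)) (huD : IsCR uD) (hdiv : divh uD = 0) :
    (∀ (u : 𝒯.P1 (Space d)) (p : 𝒯.P0 ℝ),
      IsPrimalSolution ΓD ν f F uD u → IsPressure ΓD ν f F uD u p →
      ∃ τ : 𝒯.P1 (Tensor d),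
        (∀ T x, τ T x = ν • gradh (u + uD) T - p T • (1 : Tensor d)
          - (1 / (d : ℝ)) • dyad (f T) (idSub T x)) ∧
        IsDualSolution ΓN ν f F uD τ ∧
        (∀ τ' : 𝒯.P1 (Tensor d), IsDualSolution ΓN ν f F uD τ' →
          ∃ c : ℝ, (ΓN.Nonempty → c = 0) ∧ ∀ T x, τ' T x = τ T x + c • (1 : Tensor d))) ∧
    (∀ (τ : 𝒯.P1 (Tensor d)) (w : 𝒯.P0 (Space d)),
      IsDualSolution ΓN ν f F uD τ → IsMultiplier ΓN ν uD τ w →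
      ∃ u : 𝒯.P1 (Space d),
        (∀ T x, u T x = w T + act ((1 / ν) • devh (projT τ) T - gradh uD T) (idSub T x)) ∧
        IsPrimalSolution ΓD ν f F uD u ∧
        (∀ u' : 𝒯.P1 (Space d), IsPrimalSolution ΓD ν f F uD u' → u' = u)) := by
  have hd0 : d ≠ 0 := by omega
  have hc : 0 < 1 / (2 * ν) := by positivity
  constructor
  · intro u p hu hp
    obtain ⟨hu1, hu0, -⟩ := hu
    obtain ⟨τ, hτ, hproj, htdiv, hlin⟩ :=
      exists_stress hd0 (fun T => ν • gradh (u + uD) T - p T • (1 : Tensor d)) f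
    have htr : ∀ T, (grad ((u + uD) T)).trace = 0 := fun T => by
      have h1 := congrFun hu0 T
      have h2 := congrFun hdiv T
      simp only [divh, Pi.zero_apply] at h1 h2
      rw [trace_grad, Pi.add_apply, vdiv_add, h1, h2, add_zero]
    -- The pressure drops out of the deviatoric part, and the velocity gradient is already
    -- trace-free.
    have hτu : ∀ T, dev (projT τ T) = ν • grad ((u + uD) T) := fun T => by
      rw [hproj, dev_sub, dev_smul_one hd0, sub_zero]
      exact dev_of_trace_eq_zero (by rw [Matrix.trace_smul, gradh, htr, smul_zero])
    have hadm : IsAdmissibleStress ΓN f F τ := by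
      have hdivF : tdivh (subConst τ F) = -f := by
        rw [tdivh_subConst]; exact funext htdiv
      refine ⟨isRTN_of_pairing_eq_zero hd0 hΩ hΓ.disjoint (fun T h => ?_) fun v hv => ?_, hdivF⟩
      · rw [show tdiv (subConst τ F T) = -f T from congrFun hdivF T, ← hlin]
        simp [subConst]
      -- The pressure equation says that `τ - F` is orthogonal to `V_D^h`, because `div τ = -f`.
      · have h := hp v hv
        rw [ipT_eq, ipT_eq, ip_cst_fn, ← Finset.sum_add_distrib, ← sub_eq_zero,
          ← Finset.sum_sub_distrib] at h
        rw [pairing, ← h]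
        refine Finset.sum_congr rfl fun T _ => ?_
        rw [show tdiv (subConst τ F T) = -f T from congrFun hdivF T, subConst_apply_centroid,
          hproj, inner_neg_left, frob_sub_left _ (F T)]
        simp only [gradh]
        ring
    have hval := fun σ => dualValue_eq (σ := σ) hd0 hΩ h𝒯 hν hadm hτu hu1 hu0
    refine ⟨τ, hτ, ⟨hadm, fun σ hσ => ?_⟩, fun σ hσ => ?_⟩
    · rw [dualEnergy_of_tdivh hadm.2]
      by_cases h : tdivh (subConst σ F) = -f
      · rw [dualEnergy_of_tdivh h, EReal.coe_le_coe_iff, hval σ ⟨hσ, h⟩, sub_le_self_iff]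
        exact mul_nonneg hc.le (ipT_self_nonneg _)
      · rw [dualEnergy_of_tdivh_ne h]; exact bot_le
    · have hle := hσ.2 τ hadm.1
      rw [dualEnergy_of_tdivh hadm.2, dualEnergy_of_tdivh hσ.1.2, EReal.coe_le_coe_iff,
        hval σ hσ.1, le_sub_self_iff] at hle
      -- Another maximiser has the same energy, so the quadratic remainder vanishes.
      have hz := eq_zero_of_ipT_self_nonpos (nonpos_of_mul_nonpos_right hle hc)
      obtain ⟨c, hcN, hcx⟩ := (hσ.1.isRTN_sub hd0 hadm).eq_smul_one hd0 hΩ hΓ h𝒯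
        (hσ.1.tdiv_sub_eq_zero hadm) hz
      refine ⟨c, hcN, fun T x => ?_⟩
      rw [← hcx T x]
      simp
  · intro τ w hτ hw
    obtain ⟨u, hu, huc, hug⟩ :=
      exists_velocity w fun T => (1 / ν) • devh (projT τ) T - gradh uD T
    have htr : ∀ T, (grad (u T)).trace = 0 := fun T => by
      have h2 := congrFun hdiv T
      simp only [divh, Pi.zero_apply] at h2
      rw [hug, Matrix.trace_sub, Matrix.trace_smul, devh, trace_dev hd0, gradh, trace_grad, h2,
        smul_zero, sub_zero]
    have hu0 : divh u = 0 := funext htr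
    have hτu : ∀ T, dev (projT τ T) = ν • grad ((u + uD) T) := fun T => by
      rw [Pi.add_apply, grad_add, hug, gradh, sub_add_cancel, smul_smul, mul_one_div_cancel hν.ne',
        one_smul, devh]
    -- The multiplier equation says that `u` is orthogonal to `Σ_N^h`: its mean is `w`, and its
    -- gradient is trace-free and hence pairs only with `dev Π_h σ`.
    have hu1 : IsCRD ΓD u := by
      refine isCRD_of_pairing_eq_zero hd0 hΩ hΓ.disjoint fun σ hσ => ?_
      have h := hw σ hσ
      rw [ipT_eq, ipT_eq, ip_cst_cst, Finset.mul_sum, ← Finset.sum_sub_distrib, eq_comm,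
        ← sub_eq_zero, ← Finset.sum_neg_distrib, ← Finset.sum_sub_distrib] at h
      rw [pairing, ← h]
      refine Finset.sum_congr rfl fun T _ => ?_
      rw [← projT_apply, ← frob_dev_left (htr T), huc, hug, frob_sub_right, frob_smul_right,
        frob_comm (devh (projT τ) T), frob_comm (gradh uD T), real_inner_comm (w T)]
      simp only [devh, tdivh]
      ring
    have hval := fun v => primalValue_eq (v := v) hd0 hΩ h𝒯 hτ.1 hτu hu1 hu0
    refine ⟨u, hu, ⟨hu1, hu0, fun v hv => ?_⟩, fun v hv => ?_⟩
    · rw [primalEnergy_of_divh hu0]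
      by_cases h : divh v = 0
      · rw [primalEnergy_of_divh h, EReal.coe_le_coe_iff, hval v hv h, le_add_iff_nonneg_right]
        exact mul_nonneg (by positivity) (ipT_self_nonneg _)
      · rw [primalEnergy_of_divh_ne h]; exact le_top
    · have hle := hv.2.2 u hu1
      rw [primalEnergy_of_divh hu0, primalEnergy_of_divh hv.2.1, EReal.coe_le_coe_iff,
        hval v hv.1 hv.2.1, add_le_iff_nonpos_right] at hle
      have hz := eq_zero_of_ipT_self_nonpos (nonpos_of_mul_nonpos_right hle (half_pos hν))
      exact sub_eq_zero.1 ((hv.1.sub hd0 hu1).eq_zero_of_grad hd0 hΩ hΓ h𝒯 hz)
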